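/- For integers $n,d,k\ge 0$ let $\mathrm{faces}(n,d,k)$ be the maximal number of $k$-dimensional faces of a $d$-dimensional polytope with exactly $n$ vertices ($0$ if there is no such polytope). For $r\ge 1$ put $$\phi(r,n)=\max_{r\le u\le n}\mathrm{faces}(n,u-1,u-r)$$ (with $\phi(r,n)=0$ for $n<r$), $\phi_r=\phi(r,\cdot)$, and $\phi_r^{-1}(v)=\min\{k:\ v\le\phi_r(k)\}$. The nonnegative rank $\mathrm{rank}_+(M)$ of an entrywise nonnegative matrix $M$ is the least $k$ such that $M=UV$ with entrywise nonnegative matrices $U$ with $k$ columns and $V$ with $k$ rows. Let $P=\{x\in\mathbb{R}^n : Cx\ge d,\ Ax=b\}$ be a polytope (a bounded set) with $v>1$ vertices $x_1,\dots,x_v$, and let $S_M$ be its slack matrix, i.e. the matrix with columns $Cx_j-d$, $1\le j\le v$. Let $r=\mathrm{rank}(S_M)$ and $r_+=\mathrm{rank}_+(S_M)$. Then $P$ has dimension $r-1$ and $$v\ \le\ \phi(r,r_+)=\phi_r(r_+)\ \le\ \max_{r\le u\le r_+}\binom{r_+}{u-r+1}\ \le\ \binom{r_+}{\lfloor r_+/2\rfloor}\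 \le\ 2^{r_+}.$$ An extended formulation of $P$ is a polyhedron $Q\subseteq\mathbb{R}^{n+p}$, described by finitely many linear inequalities and equations, with $P=\{x\in\mathbb{R}^n : \exists\, y\in\mathbb{R}^p,\ (x,y)\in Q\}$; its size is the number $n+p$ of variables plus the number of constraints (inequalities and equations). Let $s$ be the minimum size of an extended formulation of $P$. Then $\phi_r$ is nondecreasing, $\log_2(v)\le\phi_r^{-1}(v)\le r_+$, and $$c_1\,(r_++n)\ \le\ s\ \le\ c_2\,(r_++n),\qquad s\ \ge\ c_3\,\phi_r^{-1}(v),$$ with absolute constants $c_1,c_2,c_3>0$ (independent of $P$ and of its description). So $s=\Theta(r_++n)$, and $s$ is at least of order $\phi_r^{-1}(v)$, which is at least $\log_2(v)$. -/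

import Mathlib

open scoped Matrix

/-- The nonnegative rank of `M`: the least `k` such that `M = U * V` for some entrywise nonnegative
matrices `U` (with `k` columns) and `V` (with `k` rows). -/
noncomputable def nonnegRank {m v : ℕ} (M : Matrix (Fin m) (Fin v) ℝ) : ℕ :=
  sInf {k : ℕ | ∃ (U : Matrix (Fin m) (Fin k) ℝ) (V : Matrix (Fin k) (Fin v) ℝ),
    (∀ i j, 0 ≤ U i j) ∧ (∀ i j, 0 ≤ V i j) ∧ M = U * V}

/-- The polyhedron `{x ∈ ℝⁿ | C x ≥ d, A x = b}`. -/
def polyhedron {n f e : ℕ} (C : Matrix (Fin f) (Fin n) ℝ) (d : Fin f → ℝ)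
    (A : Matrix (Fin e) (Fin n) ℝ) (b : Fin e → ℝ) : Set (Fin n → ℝ) :=
  {x | (∀ i, d i ≤ (C *ᵥ x) i) ∧ A *ᵥ x = b}

/-- The slack matrix: its `j`-th column is `C vⱼ - d`, where `vⱼ = vert j`. -/
def slackMatrix {n f v : ℕ} (C : Matrix (Fin f) (Fin n) ℝ) (d : Fin f → ℝ)
    (vert : Fin v → (Fin n → ℝ)) : Matrix (Fin f) (Fin v) ℝ :=
  Matrix.of fun i j => (C *ᵥ vert j) i - d i

/-- The dimension of a nonempty subset of `ℝⁿ`, i.e. the dimension of its affine hull. -/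
noncomputable def affDim {n : ℕ} (S : Set (Fin n → ℝ)) : ℕ :=
  Module.finrank ℝ (vectorSpan ℝ S)

/-- A polytope: the convex hull of finitely many points. -/
def IsPolytope {n : ℕ} (T : Set (Fin n → ℝ)) : Prop :=
  ∃ S : Set (Fin n → ℝ), S.Finite ∧ T = convexHull ℝ S

/-- The `k`-faces of `T`: the nonempty faces of dimension `k`. A face is the set of maximizers over
`T` of a linear functional (the zero functional gives `T` itself). -/
def kFaces {n : ℕ} (k : ℕ) (T : Set (Fin n → ℝ)) : Set (Set (Fin n → ℝ)) :=
  {F | F.Nonempty ∧ IsExposed ℝ T F ∧ affDim F = k}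

/-- `maxFaces n d k` is the maximal number of `k`-faces of a `d`-dimensional polytope with exactly
`n` vertices (and `0` if there is no such polytope). -/
noncomputable def maxFaces (n d k : ℕ) : ℕ :=
  sSup {N : ℕ | ∃ T : Set (Fin d → ℝ), IsPolytope T ∧ affDim T = d ∧
    (T.extremePoints ℝ).ncard = n ∧ (kFaces k T).ncard = N}

/-- `φ(r, n) = max_{r ≤ u ≤ n} faces(n, u - 1, u - r)`, used for `r ≥ 1`. -/
noncomputable def phi (r n : ℕ) : ℕ :=
  (Finset.Icc r n).sup fun u => maxFaces n (u - 1) (u - r)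

/-- The (generalized) inverse of the nondecreasing function `φ_r = φ(r, ·)`:
`φ_r⁻¹(v)` is the least `k` with `v ≤ φ_r(k)`. -/
noncomputable def phiInv (r v : ℕ) : ℕ :=
  sInf {k : ℕ | v ≤ phi r k}

/-- `P ⊆ ℝⁿ` has an extended formulation of size `s`: it is the projection to the `x`-coordinates of
a polyhedron `{(x, y) ∈ ℝⁿ⁺ᵖ | E x + F y ≥ g, G x + H y = h}`, with `q` inequality constraints and
`t` equality constraints, and `s = (n + p) + (q + t)` is the number of variables plus the number of
constraints. -/
def HasExtendedFormulation {n : ℕ} (P : Set (Fin n → ℝ)) (s : ℕ) : Prop :=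
  ∃ (p q t : ℕ) (E : Matrix (Fin q) (Fin n) ℝ) (F : Matrix (Fin q) (Fin p) ℝ) (g : Fin q → ℝ)
    (G : Matrix (Fin t) (Fin n) ℝ) (H : Matrix (Fin t) (Fin p) ℝ) (h : Fin t → ℝ),
    P = {x | ∃ y : Fin p → ℝ,
      (∀ i, g i ≤ (E *ᵥ x + F *ᵥ y) i) ∧ G *ᵥ x + H *ᵥ y = h} ∧
    s = (n + p) + (q + t)

/-- The minimum size of an extended formulation of `P`. -/
noncomputable def minExtendedSize {n : ℕ} (P : Set (Fin n → ℝ)) : ℕ :=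
  sInf {s : ℕ | HasExtendedFormulation P s}

/-!
Faces of polytopes are handled through vector configurations: a polytope
`conv {x i}` is placed at height `1`, and a face becomes the zero set, among the vectors `(x i, 1)`,
of a linear functional that is nonnegative on all of them (`kFaces_convexHull_range`). In this
language the face counts of polytopes bound those of every irredundant configuration in a hyperplane
that misses the origin (`ncard_faceIndexSets_le_maxFaces`), a `k`-face is determined by `k + 1`
independent vectors (`ncard_faceIndexSets_le_choose`, which gives the binomial bounds), and pyramids
over polytopes show that `φ r` is nondecreasing (`maxFaces_le_maxFaces_pyramid`).

A bounded polyhedron with at least two points has a homogenization that is pointed and lies in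
`t > 0` apart from the origin. So `(x, t) ↦ C x - t d` is injective there, and identifies the
homogenization with the section of the nonnegative orthant by the column space `L` of the slack
matrix, whose rank is the dimension plus one (`rank_slackMatrix`).

For the bound on the number of vertices, take a nonnegative factorization `U * V` of the slack
matrix with the least number `k` of columns of `U`. By minimality these columns are irredundant, so
they generate a cone over a polytope with exactly `k` vertices. The cone over the given polytope is
the section of this cone by `L`, and each of its extreme rays, through `m` say, lies on a face
whose span meets `L` in the line of `m` only and generates everything together with `L`
(`exists_transversal_face`). These faces all have
the dimension that occurs in `φ`, and they are different for different vertices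
(`card_vertices_le_phi`).

The minimum size of an extended formulation is of the order of the nonnegative rank plus the number
of variables by Yannakakis' argument. Farkas' lemma turns an extended formulation with `q`
inequalities into a nonnegative factorization with `q + 1` columns
(`nonnegRank_add_le_of_hasExtendedFormulation`). Conversely `C x - d = U y`, `A x = b`, `y ≥ 0` is
an extended formulation, and its equations can be replaced by as many as there are variables
(`hasExtendedFormulation_nonnegRank`).
-/

/-! ### Farkas' lemma -/

/-- **Farkas' lemma**, in Bartl's algebraic form: a linear functional that is nonnegative wherever
finitely many others are nonnegative is a nonnegative combination of them. No topology and no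
finiteness of the dimension is needed. -/
theorem exists_nonneg_combination_of_forall_nonneg {X : Type*} [AddCommGroup X] [Module ℝ X]
    {n : ℕ} (φ : Fin n → Module.Dual ℝ X) (ψ : Module.Dual ℝ X)
    (h : ∀ x, (∀ i, 0 ≤ φ i x) → 0 ≤ ψ x) :
    ∃ c : Fin n → ℝ, (∀ i, 0 ≤ c i) ∧ ψ = ∑ i, c i • φ i := by
  induction n generalizing ψ with
  | zero =>
    refine ⟨0, fun i => i.elim0, ?_⟩
    ext x
    have h1 := h x (fun i => i.elim0)
    have h2 := h (-x) (fun i => i.elim0)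
    rw [map_neg] at h2
    simp
    linarith
  | succ n ih =>
    by_cases h0 : ∀ x, (∀ i : Fin n, 0 ≤ φ i.succ x) → 0 ≤ ψ x
    · obtain ⟨c, hc, e⟩ := ih (fun i => φ i.succ) ψ h0
      refine ⟨Fin.cons 0 c, fun i => ?_, ?_⟩
      · cases i using Fin.cases <;> simp [hc]
      · simp [Fin.sum_univ_succ, e]
    · push Not at h0
      obtain ⟨x₀, hx₀, hψ⟩ := h0
      have hneg : φ 0 x₀ < 0 := by
        by_contra hc
        refine absurd (h x₀ fun i => ?_) (not_le.2 hψ)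
        cases i using Fin.cases
        · exact not_lt.1 hc
        · exact hx₀ _
      -- rescaled so that `φ 0 x₁ = -1`; then `x ↦ x + φ 0 x • x₁` projects onto the kernel of `φ 0`
      set x₁ := (-(φ 0 x₀))⁻¹ • x₀ with hx₁
      have hpos : 0 < (-(φ 0 x₀))⁻¹ := inv_pos.2 (neg_pos.2 hneg)
      have h1 : φ 0 x₁ = -1 := by
        rw [hx₁, map_smul, smul_eq_mul, inv_neg, neg_mul, inv_mul_cancel₀ hneg.ne]
      let y : X →ₗ[ℝ] X := LinearMap.id + (φ 0).smulRight x₁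
      have hy : ∀ x, y x = x + φ 0 x • x₁ := fun x => by simp [y]
      obtain ⟨c, hc, e⟩ := ih (fun i => (φ i.succ).comp y) (ψ.comp y) (by
        intro x hx
        refine h _ fun i => ?_
        cases i using Fin.cases
        · simp [hy, h1]
        · exact hx _)
      refine ⟨Fin.cons (∑ i, c i * φ i.succ x₁ - ψ x₁) c, fun i => ?_, ?_⟩
      · cases i using Fin.cases
        · have : ψ x₁ ≤ 0 := by
            rw [hx₁, map_smul, smul_eq_mul]
            exact mul_nonpos_of_nonneg_of_nonpos hpos.le hψ.le
          have : 0 ≤ ∑ i, c i * φ i.succ x₁ := by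
            refine Finset.sum_nonneg fun i _ => mul_nonneg (hc i) ?_
            rw [hx₁, map_smul, smul_eq_mul]
            exact mul_nonneg hpos.le (hx₀ i)
          simp only [Fin.cons_zero]
          linarith
        · simp [hc]
      · ext x
        have := LinearMap.congr_fun e x
        simp [hy, mul_add, Finset.sum_add_distrib] at this
        simp [Fin.sum_univ_succ]
        have e2 : ∑ i, c i * (φ 0 x * φ i.succ x₁) = φ 0 x * ∑ i, c i * φ i.succ x₁ := by
          rw [Finset.mul_sum]
          exact Finset.sum_congr rfl fun i _ => by ring
        rw [e2] at this
        linarith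

theorem exists_nonneg_combination_of_forall_nonneg' {X ι : Type*} [AddCommGroup X] [Module ℝ X]
    [Fintype ι] (φ : ι → Module.Dual ℝ X) (ψ : Module.Dual ℝ X)
    (h : ∀ x, (∀ i, 0 ≤ φ i x) → 0 ≤ ψ x) :
    ∃ c : ι → ℝ, (∀ i, 0 ≤ c i) ∧ ψ = ∑ i, c i • φ i := by
  let e := Fintype.equivFin ι
  obtain ⟨c, hc, hψ⟩ := exists_nonneg_combination_of_forall_nonneg (fun i => φ (e.symm i)) ψ
    fun x hx => h x fun i => by simpa using hx (e i)
  refine ⟨fun i => c (e i), fun i => hc _, ?_⟩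
  rw [hψ, ← e.sum_comp]
  simp

/-- Farkas' lemma for a finitely generated cone: a vector outside it is separated from it by a
linear functional. -/
theorem exists_dual_neg_of_not_nonneg_combination {E ι : Type*} [AddCommGroup E] [Module ℝ E]
    [FiniteDimensional ℝ E] [Fintype ι] (g : ι → E) (p : E)
    (h : ∀ c : ι → ℝ, (∀ i, 0 ≤ c i) → p ≠ ∑ i, c i • g i) :
    ∃ a : Module.Dual ℝ E, (∀ i, 0 ≤ a (g i)) ∧ a p < 0 := by
  by_contra hcon
  push Not at hcon
  obtain ⟨c, hc, e⟩ := exists_nonneg_combination_of_forall_nonneg'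
    (fun i => Module.Dual.eval ℝ E (g i)) (Module.Dual.eval ℝ E p) (fun a ha => hcon a ha)
  refine h c hc ((Module.evalEquiv ℝ E).injective ?_)
  simpa using e

/-! ### Homogenization -/

theorem finrank_submodule_prod {E F : Type*} [AddCommGroup E] [Module ℝ E] [AddCommGroup F]
    [Module ℝ F] [FiniteDimensional ℝ E] [FiniteDimensional ℝ F] (p : Submodule ℝ E)
    (q : Submodule ℝ F) :
    Module.finrank ℝ (p.prod q) = Module.finrank ℝ p + Module.finrank ℝ q := by
  have : p.prod q = LinearMap.range (p.subtype.prodMap q.subtype) := by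
    rw [LinearMap.range_prodMap, Submodule.range_subtype, Submodule.range_subtype]
  rw [this, LinearMap.finrank_range_of_inj, Module.finrank_prod]
  exact Prod.map_injective.2 ⟨p.injective_subtype, q.injective_subtype⟩

/-- Placing a set at height `1` raises the dimension of its span by one over the dimension of its
affine hull. -/
theorem finrank_span_prod_one {E : Type*} [AddCommGroup E] [Module ℝ E] [FiniteDimensional ℝ E]
    {X : Set E} (hX : X.Nonempty) :
    Module.finrank ℝ (Submodule.span ℝ ((fun x => (x, (1 : ℝ))) '' X)) =
      Module.finrank ℝ (vectorSpan ℝ X) + 1 := by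
  obtain ⟨x₀, hx₀⟩ := hX
  let shear : (E × ℝ) ≃ₗ[ℝ] (E × ℝ) :=
    { toFun := fun z => (z.1 + z.2 • x₀, z.2)
      invFun := fun z => (z.1 - z.2 • x₀, z.2)
      map_add' := fun a b => by ext <;> simp [add_smul]; abel
      map_smul' := fun a b => by ext <;> simp [mul_smul]
      left_inv := fun a => by simp
      right_inv := fun a => by simp }
  have key : Submodule.span ℝ ((fun x => (x, (1 : ℝ))) '' X) =
      ((vectorSpan ℝ X).prod ⊤).map (shear : (E × ℝ) →ₗ[ℝ] (E × ℝ)) := by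
    apply le_antisymm
    · rw [Submodule.span_le]
      rintro _ ⟨x, hx, rfl⟩
      exact ⟨(x - x₀, 1), ⟨vsub_mem_vectorSpan ℝ hx hx₀, trivial⟩, by simp [shear]⟩
    · have hv : ∀ v ∈ vectorSpan ℝ X,
          (v, (0 : ℝ)) ∈ Submodule.span ℝ ((fun x => (x, (1 : ℝ))) '' X) := by
        intro v hv
        rw [vectorSpan_eq_span_vsub_set_right ℝ hx₀] at hv
        induction hv using Submodule.span_induction with
        | mem v hv =>
          obtain ⟨x, hx, rfl⟩ := hv
          have := Submodule.sub_mem _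
            (Submodule.subset_span (R := ℝ) (s := (fun x => (x, (1 : ℝ))) '' X) ⟨x, hx, rfl⟩)
            (Submodule.subset_span (R := ℝ) (s := (fun x => (x, (1 : ℝ))) '' X) ⟨x₀, hx₀, rfl⟩)
          simpa using this
        | zero => exact Submodule.zero_mem _
        | add a b _ _ ha hb => simpa using Submodule.add_mem _ ha hb
        | smul t a _ ha => simpa using Submodule.smul_mem _ t ha
      rintro _ ⟨⟨a, s⟩, ⟨ha, -⟩, rfl⟩
      have h2 := Submodule.smul_mem _ s
        (Submodule.subset_span (R := ℝ) (s := (fun x => (x, (1 : ℝ))) '' X) ⟨x₀, hx₀, rfl⟩)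
      simpa [shear] using Submodule.add_mem _ (hv a ha) h2
  rw [key, LinearEquiv.finrank_map_eq, finrank_submodule_prod, finrank_top, Module.finrank_self]

/-! ### Faces of a vector configuration -/

/-- The faces of rank `m` of the cone generated by the vectors `w i`, each encoded by the set of
indices of the generators lying on it, that is, by the zero set of a linear functional that is
nonnegative on all generators. -/
def faceIndexSets {ι E : Type*} [AddCommGroup E] [Module ℝ E] (w : ι → E) (m : ℕ) : Set (Set ι) :=
  {I | ∃ l : Module.Dual ℝ E, (∀ i, 0 ≤ l (w i)) ∧ I = {i | l (w i) = 0} ∧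
    Module.finrank ℝ (Submodule.span ℝ (w '' I)) = m}

/-- No vector of the configuration is a nonnegative combination of the others (a combination of the
others is one in which the vector itself has coefficient `0`). In particular no vector is zero. -/
def ConicallyIrredundant {ι E : Type*} [Fintype ι] [AddCommGroup E] [Module ℝ E] (w : ι → E) :
    Prop :=
  ∀ (i : ι) (c : ι → ℝ), (∀ j, 0 ≤ c j) → c i = 0 → w i ≠ ∑ j, c j • w j

section Configuration

variable {ι E : Type*} [AddCommGroup E] [Module ℝ E]

theorem mem_iff_mem_span_of_mem_faceIndexSets {w : ι → E} {m : ℕ} {I : Set ι}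
    (hI : I ∈ faceIndexSets w m) (i : ι) : i ∈ I ↔ w i ∈ Submodule.span ℝ (w '' I) := by
  obtain ⟨l, -, hl, -⟩ := hI
  refine ⟨fun h => Submodule.subset_span ⟨i, h, rfl⟩, fun h => ?_⟩
  have : Submodule.span ℝ (w '' I) ≤ LinearMap.ker l := by
    rw [Submodule.span_le]
    rintro _ ⟨j, hj, rfl⟩
    rw [hl] at hj
    exact hj
  have h2 : l (w i) = 0 := this h
  rw [hl]
  exact h2

/-- A face of rank `m` is determined by the indices of any `m` independent generators on it. -/
theorem ncard_faceIndexSets_le_choose [Fintype ι] (w : ι → E) (m : ℕ) :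
    (faceIndexSets w m).ncard ≤ (Fintype.card ι).choose m := by
  classical
  have key : ∀ I ∈ faceIndexSets w m, ∃ B : Finset ι, B.card = m ∧
      Submodule.span ℝ (w '' B) = Submodule.span ℝ (w '' I) := by
    intro I hI
    obtain ⟨B, hB, -, hs, hi⟩ :=
      exists_linearIndepOn_extension (linearIndepOn_empty ℝ w) (Set.empty_subset I)
    have e : Submodule.span ℝ (w '' B) = Submodule.span ℝ (w '' I) :=
      le_antisymm (Submodule.span_mono (Set.image_mono hB)) (Submodule.span_le.2 hs)
    refine ⟨B.toFinset, ?_, by rw [Set.coe_toFinset, e]⟩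
    obtain ⟨-, -, -, hm⟩ := hI
    rw [← hm, ← e, Set.image_eq_range, Set.toFinset_card]
    exact (finrank_span_eq_card hi).symm
  choose! B hB hspan using key
  have : (faceIndexSets w m).ncard ≤
      ((Finset.powersetCard m (Finset.univ : Finset ι) : Finset (Finset ι)) :
        Set (Finset ι)).ncard := by
    refine Set.ncard_le_ncard_of_injOn B (fun I hI => ?_) ?_ (Finset.finite_toSet _)
    · simpa using hB I hI
    · intro I hI J hJ hIJ
      ext i
      rw [mem_iff_mem_span_of_mem_faceIndexSets hI, mem_iff_mem_span_of_mem_faceIndexSets hJ,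
        ← hspan I hI, ← hspan J hJ, hIJ]
  rwa [Set.ncard_coe_finset, Finset.card_powersetCard, Finset.card_univ] at this

theorem finrank_span_image_of_injOn [FiniteDimensional ℝ E] {F : Type*} [AddCommGroup F]
    [Module ℝ F] (w : ι → E) (θ : E →ₗ[ℝ] F)
    (hθ : Set.InjOn θ (Submodule.span ℝ (Set.range w))) (I : Set ι) :
    Module.finrank ℝ (Submodule.span ℝ ((fun i => θ (w i)) '' I)) =
      Module.finrank ℝ (Submodule.span ℝ (w '' I)) := by
  have hle : Submodule.span ℝ (w '' I) ≤ Submodule.span ℝ (Set.range w) :=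
    Submodule.span_mono (Set.image_subset_range _ _)
  have e : Submodule.span ℝ ((fun i => θ (w i)) '' I) =
      LinearMap.range (θ.domRestrict (Submodule.span ℝ (w '' I))) := by
    rw [LinearMap.range_domRestrict, Submodule.map_span, Set.image_image]
  rw [e, LinearMap.finrank_range_of_inj]
  intro a b hab
  exact Subtype.ext (hθ (hle a.2) (hle b.2) hab)

/-- Faces are unaffected by a linear map that is injective on the span of the configuration. -/
theorem faceIndexSets_comp [FiniteDimensional ℝ E] {F : Type*} [AddCommGroup F] [Module ℝ F]
    (w : ι → E) (θ : E →ₗ[ℝ] F)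
    (hθ : Set.InjOn θ (Submodule.span ℝ (Set.range w))) (m : ℕ) :
    faceIndexSets (fun i => θ (w i)) m = faceIndexSets w m := by
  have hrank := finrank_span_image_of_injOn w θ hθ
  obtain ⟨g, hg⟩ := (θ.domRestrict (Submodule.span ℝ (Set.range w))).exists_leftInverse_of_injective
    (LinearMap.ker_eq_bot.2 fun a b hab => Subtype.ext (hθ a.2 b.2 hab))
  have hg' : ∀ i, ((g (θ (w i)) : Submodule.span ℝ (Set.range w)) : E) = w i := fun i => by
    have := LinearMap.congr_fun hg ⟨w i, Submodule.subset_span ⟨i, rfl⟩⟩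
    simpa using congrArg Subtype.val this
  ext I
  constructor
  · rintro ⟨l, h0, rfl, hm⟩
    exact ⟨l.comp θ, h0, rfl, by rw [← hm, hrank]⟩
  · rintro ⟨l, h0, rfl, hm⟩
    refine ⟨l.comp ((Submodule.subtype _).comp g), fun i => ?_, ?_, by rw [hrank, hm]⟩
    · simpa [hg'] using h0 i
    · simp [hg']

end Configuration

/-! ### Faces of a polytope -/

section Polytope

variable {ι : Type*} [Fintype ι]

theorem mem_convexHull_range_iff {E : Type*} [AddCommGroup E] [Module ℝ E] (x : ι → E) (y : E) :
    y ∈ convexHull ℝ (Set.range x) ↔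
      ∃ c : ι → ℝ, (∀ i, 0 ≤ c i) ∧ ∑ i, c i = 1 ∧ ∑ i, c i • x i = y := by
  classical
  constructor
  · intro hy
    have : convexHull ℝ (Set.range x) ⊆
        {y | ∃ c : ι → ℝ, (∀ i, 0 ≤ c i) ∧ ∑ i, c i = 1 ∧ ∑ i, c i • x i = y} := by
      refine convexHull_min ?_ ?_
      · rintro _ ⟨i, rfl⟩
        refine ⟨Pi.single i 1, fun j => ?_, by simp, by simp [Pi.single_apply]⟩
        rw [Pi.single_apply]
        split_ifs <;> norm_num
      · rintro _ ⟨c, hc, hc1, rfl⟩ _ ⟨d, hd, hd1, rfl⟩ a b ha hb hab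
        refine ⟨fun i => a * c i + b * d i, fun i => ?_, ?_, ?_⟩
        · exact add_nonneg (mul_nonneg ha (hc i)) (mul_nonneg hb (hd i))
        · rw [Finset.sum_add_distrib, ← Finset.mul_sum, ← Finset.mul_sum, hc1, hd1]
          linarith
        · simp [add_smul, mul_smul, Finset.sum_add_distrib, Finset.smul_sum]
    exact this hy
  · rintro ⟨c, hc, hc1, hy⟩
    exact mem_convexHull_of_exists_fintype c x hc hc1 (fun i => ⟨i, rfl⟩) hy

variable {d : ℕ}

theorem dual_apply_convex_combination (l : Module.Dual ℝ ((Fin d → ℝ) × ℝ)) (x : ι → Fin d → ℝ)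
    {c : ι → ℝ} (hc : ∑ i, c i = 1) :
    l (∑ i, c i • x i, 1) = ∑ i, c i * l (x i, 1) := by
  have : ((∑ i, c i • x i, 1) : (Fin d → ℝ) × ℝ) = ∑ i, c i • (x i, (1 : ℝ)) := by
    ext j
    · simp [Prod.fst_sum]
    · simp [Prod.snd_sum, hc]
  rw [this, map_sum]
  exact Finset.sum_congr rfl fun i _ => by rw [map_smul, smul_eq_mul]

theorem dual_nonneg_on_convexHull {l : Module.Dual ℝ ((Fin d → ℝ) × ℝ)} {x : ι → Fin d → ℝ}
    (hl : ∀ i, 0 ≤ l (x i, 1)) {y : Fin d → ℝ} (hy : y ∈ convexHull ℝ (Set.range x)) :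
    0 ≤ l (y, 1) := by
  obtain ⟨c, hc, hc1, rfl⟩ := (mem_convexHull_range_iff x y).1 hy
  rw [dual_apply_convex_combination l x hc1]
  exact Finset.sum_nonneg fun i _ => mul_nonneg (hc i) (hl i)

/-- The zero set of a nonnegative affine functional on a polytope is the convex hull of the
generators it contains. -/
theorem mem_convexHull_zero_set_iff {l : Module.Dual ℝ ((Fin d → ℝ) × ℝ)} {x : ι → Fin d → ℝ}
    (hl : ∀ i, 0 ≤ l (x i, 1)) (y : Fin d → ℝ) :
    y ∈ convexHull ℝ (x '' {i | l (x i, 1) = 0}) ↔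
      y ∈ convexHull ℝ (Set.range x) ∧ l (y, 1) = 0 := by
  constructor
  · intro hy
    refine ⟨convexHull_mono (Set.image_subset_range _ _) hy, ?_⟩
    rw [Set.image_eq_range, mem_convexHull_range_iff] at hy
    obtain ⟨c, -, hc1, rfl⟩ := hy
    rw [dual_apply_convex_combination l _ hc1]
    exact Finset.sum_eq_zero fun i _ => by rw [i.2, mul_zero]
  · rintro ⟨hy, h0⟩
    obtain ⟨c, hc, hc1, rfl⟩ := (mem_convexHull_range_iff x y).1 hy
    rw [dual_apply_convex_combination l x hc1,
      Finset.sum_eq_zero_iff_of_nonneg fun i _ => mul_nonneg (hc i) (hl i)] at h0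
    have hne : ∀ i, c i ≠ 0 → l (x i, 1) = 0 := fun i hi =>
      (mul_eq_zero.1 (h0 i (Finset.mem_univ i))).resolve_left hi
    classical
    have e1 : ∑ i ∈ Finset.univ.filter (fun i => c i ≠ 0), c i • x i = ∑ i, c i • x i :=
      Finset.sum_filter_of_ne fun i _ h hc => h (by rw [hc, zero_smul])
    rw [← e1]
    refine (convex_convexHull ℝ _).sum_mem (fun i _ => hc i) ?_ fun i hi => ?_
    · rw [Finset.sum_filter_ne_zero, hc1]
    · exact subset_convexHull ℝ _ ⟨i, hne i (Finset.mem_filter.1 hi).2, rfl⟩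

/-- The faces of a polytope correspond to the faces of the cone over it. -/
theorem kFaces_convexHull_range (x : ι → Fin d → ℝ) (k : ℕ) :
    kFaces k (convexHull ℝ (Set.range x)) =
      (fun I : Set ι => convexHull ℝ (x '' I)) ''
        faceIndexSets (fun i => (x i, (1 : ℝ))) (k + 1) := by
  have hdim : ∀ I : Set ι, I.Nonempty →
      Module.finrank ℝ (Submodule.span ℝ ((fun i => (x i, (1 : ℝ))) '' I)) =
        affDim (convexHull ℝ (x '' I)) + 1 := by
    intro I hI
    rw [affDim, ← direction_affineSpan, affineSpan_convexHull, direction_affineSpan,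
      ← finrank_span_prod_one (hI.image x), Set.image_image]
  ext F
  constructor
  · rintro ⟨⟨y₀, hy₀⟩, hexp, hF⟩
    obtain ⟨g, rfl⟩ := hexp ⟨y₀, hy₀⟩
    let l : Module.Dual ℝ ((Fin d → ℝ) × ℝ) :=
      g y₀ • LinearMap.snd ℝ _ _ - (g : (Fin d → ℝ) →ₗ[ℝ] ℝ).comp (LinearMap.fst ℝ _ _)
    have hl : ∀ y, l (y, 1) = g y₀ - g y := fun y => by simp [l]
    have hl0 : ∀ i, 0 ≤ l (x i, 1) := fun i => by
      rw [hl, sub_nonneg]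
      exact hy₀.2 _ (subset_convexHull ℝ _ ⟨i, rfl⟩)
    have hFI : convexHull ℝ (x '' {i | l (x i, 1) = 0}) =
        {y ∈ convexHull ℝ (Set.range x) | ∀ z ∈ convexHull ℝ (Set.range x), g z ≤ g y} := by
      ext y
      rw [mem_convexHull_zero_set_iff hl0]
      refine and_congr_right fun hy => ?_
      rw [hl, sub_eq_zero]
      exact ⟨fun h z hz => h ▸ hy₀.2 z hz, fun h => le_antisymm (h _ hy₀.1) (hy₀.2 y hy)⟩
    refine ⟨{i | l (x i, 1) = 0}, ⟨l, hl0, rfl, ?_⟩, hFI⟩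
    rw [hdim, hFI, hF]
    rw [← hFI] at hy₀
    exact Set.image_nonempty.1 (convexHull_nonempty_iff.1 ⟨y₀, hy₀⟩)
  · rintro ⟨I, ⟨l, hl0, rfl, hk⟩, rfl⟩
    have hne : {i | l (x i, 1) = 0}.Nonempty := by
      by_contra h
      rw [Set.not_nonempty_iff_eq_empty] at h
      rw [h, Set.image_empty, Submodule.span_empty, finrank_bot] at hk
      omega
    refine ⟨(hne.image x).convexHull, fun _ => ?_, ?_⟩
    · let g : (Fin d → ℝ) →ₗ[ℝ] ℝ := -(l.comp (LinearMap.inl ℝ _ _))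
      have hg : ∀ y, g y = l (0, 1) - l (y, 1) := fun y => by
        rw [← map_sub]
        simp [g, ← map_neg]
      refine ⟨LinearMap.toContinuousLinearMap g, ?_⟩
      ext y
      change y ∈ convexHull ℝ (x '' {i | l (x i, 1) = 0}) ↔
        y ∈ convexHull ℝ (Set.range x) ∧ ∀ z ∈ convexHull ℝ (Set.range x), g z ≤ g y
      rw [mem_convexHull_zero_set_iff hl0]
      refine and_congr_right fun hy => ?_
      obtain ⟨i, hi⟩ := hne
      constructor
      · intro h z hz
        have := dual_nonneg_on_convexHull hl0 hz
        rw [hg, hg, h]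
        linarith
      · intro h
        have h1 := h (x i) (subset_convexHull ℝ _ ⟨i, rfl⟩)
        have h2 := dual_nonneg_on_convexHull hl0 hy
        have hi' : l (x i, 1) = 0 := hi
        rw [hg, hg, hi'] at h1
        linarith
    · exact Nat.succ_injective ((hdim _ hne).symm.trans hk)

theorem ncard_kFaces_convexHull_range (x : ι → Fin d → ℝ) (k : ℕ) :
    (kFaces k (convexHull ℝ (Set.range x))).ncard =
      (faceIndexSets (fun i => (x i, (1 : ℝ))) (k + 1)).ncard := by
  rw [kFaces_convexHull_range, Set.InjOn.ncard_image]
  have key : ∀ I ∈ faceIndexSets (fun i => (x i, (1 : ℝ))) (k + 1),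
      I = {i | x i ∈ convexHull ℝ (x '' I)} := by
    rintro I ⟨l, hl0, rfl, -⟩
    ext i
    simp only [Set.mem_ofPred_eq]
    rw [mem_convexHull_zero_set_iff hl0]
    exact ⟨fun h => ⟨subset_convexHull ℝ _ ⟨i, rfl⟩, h⟩, fun h => h.2⟩
  intro I hI J hJ hIJ
  rw [key I hI, key J hJ]
  simp only at hIJ
  rw [hIJ]

/-- The points of an irredundant family are exactly the vertices of their convex hull. -/
theorem extremePoints_of_conicallyIrredundant {x : ι → Fin d → ℝ}
    (hx : ConicallyIrredundant fun i => (x i, (1 : ℝ))) :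
    Function.Injective x ∧ (convexHull ℝ (Set.range x)).extremePoints ℝ = Set.range x := by
  classical
  refine ⟨fun i j hij => ?_, subset_antisymm extremePoints_convexHull_subset ?_⟩
  · by_contra hne
    refine hx i (Pi.single j 1) (fun a => ?_) (by simp [hne]) ?_
    · rw [Pi.single_apply]
      split_ifs <;> norm_num
    · simp [Pi.single_apply, hij]
  · rintro _ ⟨i, rfl⟩
    -- the coefficient of `x i` in a convex combination representing `x i` must be `1`
    have uniq : ∀ c : ι → ℝ, (∀ j, 0 ≤ c j) → ∑ j, c j = 1 → ∑ j, c j • x j = x i → c i = 1 := by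
      intro c hc hc1 he
      by_contra hne
      have hle : c i ≤ 1 := hc1 ▸ Finset.single_le_sum (fun j _ => hc j) (Finset.mem_univ i)
      have hlt : 0 < 1 - c i := sub_pos.2 (lt_of_le_of_ne hle hne)
      refine hx i (fun j => if j = i then 0 else (1 - c i)⁻¹ * c j) (fun j => ?_) (by simp) ?_
      · split_ifs
        · exact le_rfl
        · exact mul_nonneg (inv_nonneg.2 hlt.le) (hc j)
      · have e1 : ((x i, 1) : (Fin d → ℝ) × ℝ) = ∑ j, c j • (x j, (1 : ℝ)) := by
          ext j
          · simp [Prod.fst_sum, ← he]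
          · simp [Prod.snd_sum, hc1]
        have e2 : ∑ j, (if j = i then 0 else (1 - c i)⁻¹ * c j) • (x j, (1 : ℝ)) =
            (1 - c i)⁻¹ • (∑ j, c j • (x j, (1 : ℝ)) - c i • (x i, (1 : ℝ))) := by
          rw [← Finset.sum_erase_eq_sub (Finset.mem_univ i), Finset.smul_sum,
            ← Finset.sum_erase Finset.univ (a := i) (by simp)]
          refine Finset.sum_congr rfl fun j hj => ?_
          rw [if_neg (Finset.ne_of_mem_erase hj), mul_smul]
        rw [e2, ← e1, eq_inv_smul_iff₀ hlt.ne', sub_smul, one_smul]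
    have eqOf : ∀ c : ι → ℝ, (∀ j, 0 ≤ c j) → ∑ j, c j = 1 → c i = 1 → ∑ j, c j • x j = x i := by
      intro c hc hc1 hci
      have h0 : ∀ j ∈ Finset.univ.erase i, c j = 0 := by
        rw [← Finset.sum_eq_zero_iff_of_nonneg fun j _ => hc j]
        rw [Finset.sum_erase_eq_sub (Finset.mem_univ i), hc1, hci, sub_self]
      rw [Finset.sum_eq_single i, hci, one_smul]
      · intro j _ hj
        rw [h0 j (Finset.mem_erase.2 ⟨hj, Finset.mem_univ _⟩), zero_smul]
      · simp
    refine mem_extremePoints.2 ⟨subset_convexHull ℝ _ ⟨i, rfl⟩, ?_⟩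
    intro a ha b hb hab
    obtain ⟨s, t, hs, ht, hst, he⟩ := hab
    obtain ⟨α, hα, hα1, rfl⟩ := (mem_convexHull_range_iff x a).1 ha
    obtain ⟨β, hβ, hβ1, rfl⟩ := (mem_convexHull_range_iff x b).1 hb
    have h1 := uniq (fun j => s * α j + t * β j)
      (fun j => add_nonneg (mul_nonneg hs.le (hα j)) (mul_nonneg ht.le (hβ j)))
      (by rw [Finset.sum_add_distrib, ← Finset.mul_sum, ← Finset.mul_sum, hα1, hβ1]; linarith)
      (by rw [← he]; simp [add_smul, mul_smul, Finset.sum_add_distrib, Finset.smul_sum])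
    have hαi : α i ≤ 1 := hα1 ▸ Finset.single_le_sum (fun j _ => hα j) (Finset.mem_univ i)
    have hβi : β i ≤ 1 := hβ1 ▸ Finset.single_le_sum (fun j _ => hβ j) (Finset.mem_univ i)
    refine ⟨eqOf α hα hα1 ?_, eqOf β hβ hβ1 ?_⟩ <;> nlinarith

end Polytope

/-! ### Maximal numbers of faces -/

section MaxFaces

variable {d : ℕ}

theorem convexHull_extremePoints_of_isPolytope {T : Set (Fin d → ℝ)} (hT : IsPolytope T) :
    (T.extremePoints ℝ).Finite ∧ convexHull ℝ (T.extremePoints ℝ) = T := by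
  obtain ⟨S, hS, rfl⟩ := hT
  have hfin : ((convexHull ℝ S).extremePoints ℝ).Finite := hS.subset extremePoints_convexHull_subset
  refine ⟨hfin, ?_⟩
  have := closure_convexHull_extremePoints (hS.isCompact_convexHull ℝ) (convex_convexHull ℝ S)
  rwa [(hfin.isClosed_convexHull ℝ).closure_eq] at this

/-- The vertices of a convex set, placed at height `1`, are irredundant. -/
theorem conicallyIrredundant_of_mem_extremePoints {ι : Type*} [Fintype ι] {T : Set (Fin d → ℝ)}
    (hT : Convex ℝ T) {x : ι → Fin d → ℝ} (hx : Function.Injective x)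
    (hxT : ∀ i, x i ∈ T.extremePoints ℝ) : ConicallyIrredundant fun i => (x i, (1 : ℝ)) := by
  classical
  intro i c hc hci he
  have h1 : x i = ∑ j, c j • x j := by
    have := congrArg Prod.fst he
    simpa [Prod.fst_sum] using this
  have h2 : ∑ j, c j = 1 := by
    have := congrArg Prod.snd he
    simpa [Prod.snd_sum] using this.symm
  refine (hT.mem_extremePoints_iff_mem_sdiff_convexHull_sdiff.1 (hxT i)).2 ?_
  have e1 : ∑ j ∈ Finset.univ.filter (fun j => c j ≠ 0), c j • x j = ∑ j, c j • x j :=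
    Finset.sum_filter_of_ne fun j _ h hc => h (by rw [hc, zero_smul])
  rw [h1, ← e1]
  refine (convex_convexHull ℝ _).sum_mem (fun j _ => hc j) ?_ fun j hj => ?_
  · rw [Finset.sum_filter_ne_zero, h2]
  · refine subset_convexHull ℝ _ ⟨(hxT j).1, fun h => (Finset.mem_filter.1 hj).2 ?_⟩
    rw [e1, ← h1] at h
    rw [hx h, hci]

/-- Every polytope is the convex hull of an irredundant family of points, one for each vertex. -/
theorem exists_irredundant_of_isPolytope {T : Set (Fin d → ℝ)} (hT : IsPolytope T) {n : ℕ}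
    (hn : (T.extremePoints ℝ).ncard = n) :
    ∃ x : Fin n → Fin d → ℝ,
      ConicallyIrredundant (fun i => (x i, (1 : ℝ))) ∧ T = convexHull ℝ (Set.range x) := by
  obtain ⟨hfin, hconv⟩ := convexHull_extremePoints_of_isPolytope hT
  have hcard : Nat.card (T.extremePoints ℝ) = n := hn
  have := hfin.to_subtype
  let e := (Finite.equivFinOfCardEq hcard).symm
  refine ⟨fun i => e i, ?_, ?_⟩
  · refine conicallyIrredundant_of_mem_extremePoints (T := T) ?_
      (Subtype.val_injective.comp e.injective) fun i => (e i).2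
    rw [← hconv]
    exact convex_convexHull ℝ _
  · have : (Set.range fun i => (e i : Fin d → ℝ)) = T.extremePoints ℝ := by
      rw [show (fun i => (e i : Fin d → ℝ)) = Subtype.val ∘ e from rfl, e.surjective.range_comp,
        Subtype.range_coe]
    rw [this, hconv]

theorem ncard_kFaces_le_choose {T : Set (Fin d → ℝ)} (hT : IsPolytope T) (k : ℕ) :
    (kFaces k T).ncard ≤ (T.extremePoints ℝ).ncard.choose (k + 1) := by
  obtain ⟨x, -, hx⟩ := exists_irredundant_of_isPolytope hT rfl
  have h := ncard_faceIndexSets_le_choose (fun i => (x i, (1 : ℝ))) (k + 1)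
  rw [← ncard_kFaces_convexHull_range, ← hx, Fintype.card_fin] at h
  exact h

/-- The set of face numbers in the definition of `maxFaces` is bounded, so that its supremum is not
a junk value. -/
theorem le_choose_of_mem_faceNumbers {n d k N : ℕ}
    (hN : N ∈ {N : ℕ | ∃ T : Set (Fin d → ℝ), IsPolytope T ∧ affDim T = d ∧
      (T.extremePoints ℝ).ncard = n ∧ (kFaces k T).ncard = N}) : N ≤ n.choose (k + 1) := by
  obtain ⟨T, hT, -, rfl, rfl⟩ := hN
  exact ncard_kFaces_le_choose hT k

theorem maxFaces_le_choose (n d k : ℕ) : maxFaces n d k ≤ n.choose (k + 1) :=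
  csSup_le' fun _ hN => le_choose_of_mem_faceNumbers hN

/-- The face counts of irredundant configurations in a hyperplane `σ = 1` of any space are
bounded by those of polytopes: a cross-section of the cone they generate is a polytope. -/
theorem ncard_faceIndexSets_le_maxFaces {ι E : Type*} [Fintype ι] [AddCommGroup E] [Module ℝ E]
    [FiniteDimensional ℝ E] {w : ι → E} (hw : ConicallyIrredundant w) (σ : Module.Dual ℝ E)
    (hσ : ∀ i, σ (w i) = 1)
    (hd : Module.finrank ℝ (Submodule.span ℝ (Set.range w)) = d + 1) (k : ℕ) :
    (faceIndexSets w (k + 1)).ncard ≤ maxFaces (Fintype.card ι) d k := by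
  set W := Submodule.span ℝ (Set.range w) with hW
  have hwW : ∀ i, w i ∈ W := fun i => Submodule.subset_span ⟨i, rfl⟩
  have hne : Nonempty ι := by
    by_contra h
    rw [not_nonempty_iff] at h
    rw [hW, Set.range_eq_empty, Submodule.span_empty, finrank_bot] at hd
    omega
  have hN : Module.finrank ℝ (LinearMap.ker (σ.domRestrict W)) = Module.finrank ℝ (Fin d → ℝ) := by
    have h1 := (σ.domRestrict W).finrank_range_add_finrank_ker
    have h2 : LinearMap.range (σ.domRestrict W) = ⊤ := by
      rw [LinearMap.range_eq_top]
      intro t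
      exact ⟨t • ⟨w hne.some, hwW _⟩, by simp [hσ]⟩
    rw [h2, finrank_top, Module.finrank_self, hd] at h1
    rw [Module.finrank_fin_fun]
    omega
  let φ := LinearEquiv.ofFinrankEq _ _ hN
  -- coordinates on the section `σ = 1` of the span, extended to the whole space
  obtain ⟨ρ, hρ⟩ := LinearMap.exists_leftInverse_of_injective
    (W.subtype.comp (LinearMap.ker (σ.domRestrict W)).subtype)
    (LinearMap.ker_eq_bot.2 (W.injective_subtype.comp (Submodule.injective_subtype _)))
  let θ : E →ₗ[ℝ] (Fin d → ℝ) × ℝ := (φ.toLinearMap.comp ρ).prod σ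
  have hθ : Set.InjOn θ W := by
    intro y hy z hz hyz
    have h1 : φ (ρ y) = φ (ρ z) := congrArg Prod.fst hyz
    have h2 : σ y = σ z := congrArg Prod.snd hyz
    let u : LinearMap.ker (σ.domRestrict W) :=
      ⟨⟨y - z, W.sub_mem hy hz⟩, by simp [h2]⟩
    have h3 : ρ (y - z) = u := LinearMap.congr_fun hρ u
    rw [map_sub, φ.injective h1, sub_self] at h3
    have h4 : ((u : W) : E) = 0 := by rw [← h3]; rfl
    exact sub_eq_zero.1 h4
  let x : ι → Fin d → ℝ := fun i => φ (ρ (w i))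
  have hx : (fun i => θ (w i)) = fun i => (x i, (1 : ℝ)) := by
    funext i
    exact Prod.ext rfl (hσ i)
  have hirr : ConicallyIrredundant fun i => (x i, (1 : ℝ)) := by
    rw [← hx]
    intro i c hc hci he
    refine hw i c hc hci (hθ (hwW i) (W.sum_mem fun j _ => W.smul_mem _ (hwW j)) ?_)
    refine he.trans ?_
    simp
  obtain ⟨hinj, hext⟩ := extremePoints_of_conicallyIrredundant hirr
  have hdim : affDim (convexHull ℝ (Set.range x)) = d := by
    have h1 := finrank_span_prod_one (Set.range_nonempty x)
    have h2 := finrank_span_image_of_injOn w θ hθ Set.univ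
    rw [hx, Set.image_univ, Set.image_univ, hd] at h2
    rw [← Set.range_comp] at h1
    rw [affDim, ← direction_affineSpan, affineSpan_convexHull, direction_affineSpan]
    exact Nat.succ_injective (h1.symm.trans h2)
  refine le_csSup ⟨_, fun N hN => le_choose_of_mem_faceNumbers hN⟩
    ⟨convexHull ℝ (Set.range x), ⟨_, Set.finite_range x, rfl⟩, hdim, ?_, ?_⟩
  · rw [hext, ← Set.image_univ, Set.ncard_image_of_injective _ hinj, Set.ncard_univ,
      Nat.card_eq_fintype_card]
  · rw [ncard_kFaces_convexHull_range, ← hx, faceIndexSets_comp w θ hθ]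

/-- The pyramid over a polytope: one more vertex, and a face of one dimension more through the apex
for each face of the base. -/
theorem maxFaces_le_maxFaces_pyramid {n : ℕ} (hn : n ≠ 0) (d k : ℕ) :
    maxFaces n d k ≤ maxFaces (n + 1) (d + 1) (k + 1) := by
  refine csSup_le' ?_
  rintro _ ⟨T, hT, hdim, hTn, rfl⟩
  obtain ⟨x, hirr, hx⟩ := exists_irredundant_of_isPolytope hT hTn
  rw [hx, ncard_kFaces_convexHull_range]
  set y : Fin n → (Fin d → ℝ) × ℝ := fun i => (x i, (1 : ℝ)) with hy
  -- the pyramid, with apex indexed by `none`; the sum of the last two coordinates is `1`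
  let w : Option (Fin n) → ((Fin d → ℝ) × ℝ) × ℝ := fun o => o.elim (0, 1) fun i => (y i, 0)
  have hspan : ∀ I : Set (Fin n),
      Module.finrank ℝ (Submodule.span ℝ (w '' (insert none (some '' I)))) =
        Module.finrank ℝ (Submodule.span ℝ (y '' I)) + 1 := by
    intro I
    have : Submodule.span ℝ (w '' (insert none (some '' I))) =
        (Submodule.span ℝ (y '' I)).prod (Submodule.span ℝ {1}) := by
      have h : w '' (insert none (some '' I)) =
          LinearMap.inl ℝ ((Fin d → ℝ) × ℝ) ℝ '' (y '' I) ∪ LinearMap.inr ℝ _ ℝ '' {1} := by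
        rw [Set.image_insert_eq, Set.image_image, Set.image_image, Set.image_singleton,
          Set.union_singleton]
        rfl
      rw [h, LinearMap.span_inl_union_inr]
    rw [this, finrank_submodule_prod, finrank_span_singleton one_ne_zero]
  have h1 : (faceIndexSets y (k + 1)).ncard ≤ (faceIndexSets w (k + 1 + 1)).ncard := by
    refine Set.ncard_le_ncard_of_injOn (fun I => insert none (some '' I)) ?_ ?_ (Set.toFinite _)
    · rintro I ⟨l, hl0, rfl, hl⟩
      refine ⟨l.comp (LinearMap.fst ℝ _ _), ?_, ?_, by rw [hspan, hl]⟩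
      · rintro (_ | i)
        · simp [w]
        · simpa [w] using hl0 i
      · ext (_ | i) <;> simp [w]
    · intro I _ J _ hIJ
      ext i
      have := Set.ext_iff.1 hIJ (some i)
      simpa using this
  refine h1.trans ?_
  have h2 := ncard_faceIndexSets_le_maxFaces (d := d + 1) (w := w) ?_
    ((LinearMap.snd ℝ _ _).comp (LinearMap.fst ℝ _ _) + LinearMap.snd ℝ _ _) ?_ ?_ (k + 1)
  · simpa using h2
  · rintro (_ | i) c hc hci he
    · have := congrArg Prod.snd he
      simp [w, Fintype.sum_option, hci, Prod.snd_sum] at this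
    · refine hirr i (fun j => c (some j)) (fun j => hc _) hci ?_
      have := congrArg Prod.fst he
      simpa [w, Fintype.sum_option, Prod.fst_sum] using this
  · rintro (_ | i) <;> simp [w, hy]
  · have h3 := hspan Set.univ
    have h4 : (insert none (some '' Set.univ) : Set (Option (Fin n))) = Set.univ := by
      ext (_ | i) <;> simp
    rw [h4, Set.image_univ, Set.image_univ] at h3
    have : Nonempty (Fin n) := ⟨⟨0, Nat.pos_of_ne_zero hn⟩⟩
    have h5 := finrank_span_prod_one (Set.range_nonempty x)
    rw [← Set.range_comp] at h5
    rw [h3, hy]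
    refine congrArg (· + 1) (h5.trans (congrArg (· + 1) ?_))
    rw [affDim, hx, ← direction_affineSpan, affineSpan_convexHull, direction_affineSpan] at hdim
    exact hdim

end MaxFaces

/-! ### The function `φ` -/

theorem phi_le_sup_choose (r n : ℕ) :
    phi r n ≤ (Finset.Icc r n).sup fun u => n.choose (u - r + 1) :=
  Finset.sup_mono_fun fun _ _ => maxFaces_le_choose _ _ _

theorem phi_le_two_pow (r n : ℕ) : phi r n ≤ 2 ^ n :=
  Finset.sup_le fun _ _ => (maxFaces_le_choose _ _ _).trans (Nat.choose_le_two_pow _ _)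

theorem monotone_phi {r : ℕ} (hr : r ≠ 0) : Monotone (phi r) := by
  refine monotone_nat_of_le_succ fun n => Finset.sup_le fun u hu => ?_
  rw [Finset.mem_Icc] at hu
  obtain ⟨d, rfl⟩ : ∃ d, u = d + 1 := ⟨u - 1, by omega⟩
  refine (maxFaces_le_maxFaces_pyramid (by omega) _ _).trans ?_
  have h := Finset.le_sup (f := fun u => maxFaces (n + 1) (u - 1) (u - r))
    (Finset.mem_Icc.2 ⟨hu.1.trans (Nat.le_succ _), Nat.succ_le_succ hu.2⟩)
  rwa [show d + 1 + 1 - 1 = d + 1 - 1 + 1 by omega,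
    show d + 1 + 1 - r = d + 1 - r + 1 by omega] at h

/-! ### Faces transversal to a subspace -/

section Transversal

variable {ι E : Type*} [Fintype ι] [AddCommGroup E] [Module ℝ E]

/-- If a functional is nonnegative on generators and vanishes on a nonnegative combination of them,
it vanishes on every generator that occurs. -/
theorem dual_apply_eq_zero_of_combination {w : ι → E} {J : Set ι} {c : ι → ℝ} {m : E}
    (hc : ∀ i, 0 ≤ c i) (hcJ : ∀ i, c i ≠ 0 → i ∈ J) (hm : m = ∑ i, c i • w i)
    {a : Module.Dual ℝ E} (ha : ∀ i ∈ J, 0 ≤ a (w i)) (ham : a m = 0) {i : ι} (hi : c i ≠ 0) :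
    a (w i) = 0 := by
  rw [hm, map_sum] at ham
  have h := (Finset.sum_eq_zero_iff_of_nonneg fun j _ => ?_).1 ham i (Finset.mem_univ i)
  · rw [map_smul, smul_eq_mul] at h
    exact (mul_eq_zero.1 h).resolve_left hi
  · rw [map_smul, smul_eq_mul]
    by_cases hj : c j = 0
    · rw [hj, zero_mul]
    · exact mul_nonneg (hc j) (ha j (hcJ j hj))

/-- Starting from `a`, moving in the direction `b` until another generator is annihilated. -/
theorem exists_pivot {w : ι → E} {J : Set ι} {a b : Module.Dual ℝ E}
    (ha : ∀ i ∈ J, 0 ≤ a (w i)) (hb : ∃ i ∈ J, b (w i) < 0) :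
    ∃ t : ℝ, (∀ i ∈ J, 0 ≤ (a + t • b) (w i)) ∧ ∃ i ∈ J, b (w i) ≠ 0 ∧ (a + t • b) (w i) = 0 := by
  classical
  obtain ⟨i₀, hi₀, hmin⟩ := Finset.exists_min_image
    (Finset.univ.filter fun i => i ∈ J ∧ b (w i) < 0) (fun i => a (w i) / -b (w i))
    (by obtain ⟨i, hi⟩ := hb; exact ⟨i, by simpa using hi⟩)
  simp only [Finset.mem_filter, Finset.mem_univ, true_and] at hi₀ hmin
  have hpos : 0 < -b (w i₀) := neg_pos.2 hi₀.2
  refine ⟨a (w i₀) / -b (w i₀), fun i hi => ?_, i₀, hi₀.1, hi₀.2.ne, ?_⟩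
  · simp only [LinearMap.add_apply, LinearMap.smul_apply, smul_eq_mul]
    rcases lt_or_ge (b (w i)) 0 with h | h
    · have h1 := hmin i ⟨hi, h⟩
      rw [le_div_iff₀ (neg_pos.2 h)] at h1
      linarith
    · exact add_nonneg (ha i hi) (mul_nonneg (div_nonneg (ha _ hi₀.1) hpos.le) h)
  · simp only [LinearMap.add_apply, LinearMap.smul_apply, smul_eq_mul]
    have : a (w i₀) / -b (w i₀) * b (w i₀) = -a (w i₀) := by
      have h := div_mul_cancel₀ (a (w i₀)) hpos.ne'
      linarith
    linarith

/-- If `p` leaves the cone generated by `w i`, `i ∈ J`, immediately when one moves from the point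
`m` of the cone in the direction `p`, then some facet of the cone contains `m` and is crossed by
that motion. -/
theorem exists_facet_separating [FiniteDimensional ℝ E] (w : ι → E) (J : Set ι) {c : ι → ℝ}
    {m p : E} (hc : ∀ i, 0 ≤ c i) (hcJ : ∀ i, c i ≠ 0 → i ∈ J) (hm : m = ∑ i, c i • w i)
    (hp : ∀ (e : ι → ℝ) (s : ℝ), (∀ i, 0 ≤ e i) → p ≠ ∑ i, e i • w i + s • m) :
    ∃ a : Module.Dual ℝ E, (∀ i ∈ J, 0 ≤ a (w i)) ∧ a m = 0 ∧ a p < 0 ∧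
      Submodule.span ℝ (w '' J) ≤
        Submodule.span ℝ (w '' {i | i ∈ J ∧ a (w i) = 0}) ⊔ Submodule.span ℝ {p} := by
  classical
  -- among the separating functionals, one whose set of zeros on the generators is maximal
  let 𝒦 : Set (Set ι) := {K | ∃ a : Module.Dual ℝ E, (∀ i ∈ J, 0 ≤ a (w i)) ∧ a m = 0 ∧ a p < 0 ∧
    K = {i | i ∈ J ∧ a (w i) = 0}}
  have hne : 𝒦.Nonempty := by
    obtain ⟨a, ha, hap⟩ := exists_dual_neg_of_not_nonneg_combination
      (fun o : Option ι => o.elim (-m) fun i => if i ∈ J then w i else 0) p (by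
        intro e he hpe
        refine hp (fun i => if i ∈ J then e (some i) else 0) (-e none) (fun i => ?_) ?_
        · split_ifs
          · exact he _
          · exact le_rfl
        · rw [hpe, Fintype.sum_option, add_comm]
          simp only [Option.elim, smul_neg, neg_smul, smul_ite, smul_zero, ite_smul, zero_smul])
    have haJ : ∀ i ∈ J, 0 ≤ a (w i) := fun i hi => by simpa [hi] using ha (some i)
    refine ⟨_, a, haJ, le_antisymm (by simpa using ha none) ?_, hap, rfl⟩
    rw [hm, map_sum]
    refine Finset.sum_nonneg fun i _ => ?_
    rw [map_smul, smul_eq_mul]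
    by_cases hi : c i = 0
    · rw [hi, zero_mul]
    · exact mul_nonneg (hc i) (haJ i (hcJ i hi))
  obtain ⟨K, hK⟩ := (Set.toFinite 𝒦).exists_maximal hne
  obtain ⟨a, haJ, ham, hap, rfl⟩ := hK.prop
  refine ⟨a, haJ, ham, hap, ?_⟩
  rw [Submodule.span_le]
  rintro _ ⟨i, hi, rfl⟩
  by_contra hiZ
  -- otherwise some functional `b` vanishes on the zeros of `a` and on `p` but not on `w i`, and
  -- adding a multiple of it to `a` produces a further zero
  obtain ⟨b₀, hb₀i, hb₀⟩ := Submodule.exists_le_ker_of_notMem hiZ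
  obtain ⟨b, hbi, hb⟩ : ∃ b : Module.Dual ℝ E, b (w i) < 0 ∧
      Submodule.span ℝ (w '' {i | i ∈ J ∧ a (w i) = 0}) ⊔ Submodule.span ℝ {p} ≤
        LinearMap.ker b := by
    rcases lt_or_gt_of_ne hb₀i with h | h
    · exact ⟨b₀, h, hb₀⟩
    · refine ⟨-b₀, by simpa using h, fun z hz => ?_⟩
      have : b₀ z = 0 := hb₀ hz
      simp [this]
  have hbK : ∀ j ∈ J, a (w j) = 0 → b (w j) = 0 := fun j hj h =>
    hb (Submodule.mem_sup_left (Submodule.subset_span ⟨j, ⟨hj, h⟩, rfl⟩))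
  have hbp : b p = 0 := hb (Submodule.mem_sup_right (Submodule.mem_span_singleton_self p))
  have hbm : b m = 0 := by
    rw [hm, map_sum]
    refine Finset.sum_eq_zero fun j _ => ?_
    rw [map_smul, smul_eq_mul]
    by_cases hj : c j = 0
    · rw [hj, zero_mul]
    · rw [hbK j (hcJ j hj) (dual_apply_eq_zero_of_combination hc hcJ hm haJ ham hj), mul_zero]
  obtain ⟨t, ht, j, hj, hbj, hjt⟩ := exists_pivot haJ ⟨i, hi, hbi⟩
  have hle := hK.le_of_ge (y := {i | i ∈ J ∧ (a + t • b) (w i) = 0})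
    ⟨a + t • b, ht, by simp [ham, hbm], by simpa [hbp] using hap, rfl⟩
    (fun k hk => ⟨hk.1, by simp [hk.2, hbK k hk.1 hk.2]⟩)
  exact hbj (hbK j hj (hle ⟨hj, hjt⟩).2)

/-- Let `m` span an extreme ray of the intersection of the cone generated by `w` with a subspace
`L` of the span of `w`. Then some face of the cone contains `m` and has a span that meets `L` in
the line of `m` only and together with `L` generates everything. It is found as a face minimal among
those that contain `m` and generate everything together with `L`: as long as its span contains
a further direction of `L`, a facet of it separates. -/
theorem exists_transversal_face [FiniteDimensional ℝ E] (w : ι → E) {L : Submodule ℝ E}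
    (hL : L ≤ Submodule.span ℝ (Set.range w)) {c : ι → ℝ} {m : E} (hc : ∀ i, 0 ≤ c i)
    (hm : m = ∑ i, c i • w i) (hmL : m ∈ L)
    (hext : ∀ p ∈ L, ∀ (e e' : ι → ℝ) (s s' : ℝ), (∀ i, 0 ≤ e i) → (∀ i, 0 ≤ e' i) →
      p = ∑ i, e i • w i + s • m → -p = ∑ i, e' i • w i + s' • m → p ∈ Submodule.span ℝ {m}) :
    ∃ (l : Module.Dual ℝ E) (I : Set ι), (∀ i, 0 ≤ l (w i)) ∧ I = {i | l (w i) = 0} ∧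
      Submodule.span ℝ (w '' I) ⊔ L = Submodule.span ℝ (Set.range w) ∧
      Submodule.span ℝ (w '' I) ⊓ L = Submodule.span ℝ {m} := by
  classical
  let 𝒥 : Set (Set ι) := {J | ∃ l : Module.Dual ℝ E, (∀ i, 0 ≤ l (w i)) ∧ l m = 0 ∧
    J = {i | l (w i) = 0} ∧ Submodule.span ℝ (w '' J) ⊔ L = Submodule.span ℝ (Set.range w)}
  have hne : 𝒥.Nonempty := by
    refine ⟨Set.univ, 0, fun i => le_rfl, rfl, by ext; simp, ?_⟩
    rw [Set.image_univ, sup_eq_left]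
    exact hL
  obtain ⟨J, hJ⟩ := (Set.toFinite 𝒥).exists_minimal hne
  obtain ⟨l, hl0, hlm, hJl, hJL⟩ := hJ.prop
  have hcJ : ∀ i, c i ≠ 0 → i ∈ J := fun i hi => by
    rw [hJl]
    exact dual_apply_eq_zero_of_combination (J := Set.univ) hc (fun _ _ => trivial) hm
      (fun i _ => hl0 i) hlm hi
  refine ⟨l, J, hl0, hJl, hJL, le_antisymm ?_ ?_⟩
  · rintro p ⟨hpZ, hpL⟩
    by_contra hpm
    obtain ⟨q, hqZ, hqL, hq⟩ : ∃ q ∈ Submodule.span ℝ (w '' J), q ∈ L ∧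
        ∀ (e : ι → ℝ) (s : ℝ), (∀ i, 0 ≤ e i) → q ≠ ∑ i, e i • w i + s • m := by
      by_cases h : ∀ (e : ι → ℝ) (s : ℝ), (∀ i, 0 ≤ e i) → p ≠ ∑ i, e i • w i + s • m
      · exact ⟨p, hpZ, hpL, h⟩
      · push Not at h
        obtain ⟨e, s, he, hps⟩ := h
        exact ⟨-p, neg_mem hpZ, neg_mem hpL, fun e' s' he' h =>
          hpm (hext p hpL e e' s s' he he' hps h)⟩
    obtain ⟨a, haJ, ham, haq, haZ⟩ := exists_facet_separating w J hc hcJ hm hq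
    -- a large multiple of `l` makes `a` positive on the generators outside the face `J`
    obtain ⟨N, hN⟩ : ∃ N : ℝ, ∀ i, i ∉ J → 0 < N * l (w i) + a (w i) := by
      refine ⟨1 + ∑ i, |a (w i)| / l (w i), fun i hi => ?_⟩
      have hpos : 0 < l (w i) := lt_of_le_of_ne (hl0 i) fun h => hi (by rw [hJl]; exact h.symm)
      have h1 : |a (w i)| / l (w i) ≤ ∑ i, |a (w i)| / l (w i) :=
        Finset.single_le_sum (f := fun i => |a (w i)| / l (w i))
          (fun j _ => div_nonneg (abs_nonneg _) (hl0 j)) (Finset.mem_univ i)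
      rw [div_le_iff₀ hpos] at h1
      have h2 := neg_abs_le (a (w i))
      rw [add_mul, one_mul]
      linarith
    have hlJ : ∀ i, i ∈ J → l (w i) = 0 := fun i hi => by rw [hJl] at hi; exact hi
    have hle := hJ.le_of_le (y := {i | i ∈ J ∧ a (w i) = 0}) (by
      refine ⟨N • l + a, fun i => ?_, by simp [hlm, ham], ?_, ?_⟩
      · by_cases hi : i ∈ J
        · simpa [hlJ i hi] using haJ i hi
        · simpa using (hN i hi).le
      · ext i
        by_cases hi : i ∈ J
        · simp [hi, hlJ i hi]
        · simpa [hi] using (hN i hi).ne'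
      · refine le_antisymm (sup_le (Submodule.span_mono (Set.image_subset_range _ _)) hL) ?_
        rw [← hJL]
        refine sup_le (haZ.trans (sup_le_sup_left ?_ _)) le_sup_right
        rw [Submodule.span_singleton_le_iff_mem]
        exact hqL) (fun i hi => hi.1)
    have hker : Submodule.span ℝ (w '' J) ≤ LinearMap.ker a := by
      rw [Submodule.span_le]
      rintro _ ⟨i, hi, rfl⟩
      exact (hle hi).2
    exact haq.ne (hker hqZ)
  · rw [Submodule.span_singleton_le_iff_mem]
    refine ⟨?_, hmL⟩
    rw [hm]
    refine Submodule.sum_mem _ fun i _ => ?_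
    by_cases hi : c i = 0
    · rw [hi, zero_smul]
      exact Submodule.zero_mem _
    · exact Submodule.smul_mem _ _ (Submodule.subset_span ⟨i, hcJ i hi, rfl⟩)

end Transversal

/-! ### Nonnegative factorizations -/

section NonnegRank

variable {m v : ℕ}

theorem nonnegRank_le_card {κ : Type*} [Fintype κ] {M : Matrix (Fin m) (Fin v) ℝ}
    (U : Matrix (Fin m) κ ℝ) (V : Matrix κ (Fin v) ℝ) (hU : ∀ i j, 0 ≤ U i j)
    (hV : ∀ i j, 0 ≤ V i j) (hM : M = U * V) : nonnegRank M ≤ Fintype.card κ := by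
  let e := (Fintype.equivFin κ).symm
  refine Nat.sInf_le ⟨U.submatrix id e, V.submatrix e id, fun i j => hU _ _, fun i j => hV _ _, ?_⟩
  rw [Matrix.submatrix_mul_equiv, hM, Matrix.submatrix_id_id]

theorem exists_nonneg_factorization {M : Matrix (Fin m) (Fin v) ℝ} (hM : ∀ i j, 0 ≤ M i j) {k : ℕ}
    (hk : k = nonnegRank M) :
    ∃ (U : Matrix (Fin m) (Fin k) ℝ) (V : Matrix (Fin k) (Fin v) ℝ),
      (∀ i j, 0 ≤ U i j) ∧ (∀ i j, 0 ≤ V i j) ∧ M = U * V := by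
  rw [hk]
  exact Nat.sInf_mem (s := {k : ℕ | ∃ (U : Matrix (Fin m) (Fin k) ℝ) (V : Matrix (Fin k) (Fin v) ℝ),
    (∀ i j, 0 ≤ U i j) ∧ (∀ i j, 0 ≤ V i j) ∧ M = U * V})
    ⟨v, M, 1, hM, fun i j => by rw [Matrix.one_apply]; split_ifs <;> norm_num, by simp⟩

/-- In a nonnegative factorization of the least possible size, no column of the left factor is
a nonnegative combination of the others: it could be eliminated. -/
theorem conicallyIrredundant_col_of_eq_nonnegRank {M : Matrix (Fin m) (Fin v) ℝ} {k : ℕ}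
    (hk : k = nonnegRank M) {U : Matrix (Fin m) (Fin k) ℝ} {V : Matrix (Fin k) (Fin v) ℝ}
    (hU : ∀ i j, 0 ≤ U i j) (hV : ∀ i j, 0 ≤ V i j) (hM : M = U * V) :
    ConicallyIrredundant U.col := by
  intro i c hc hci he
  obtain _ | k := k
  · exact i.elim0
  have h := nonnegRank_le_card (M := M) (U.submatrix id i.succAbove)
    (Matrix.of fun a b => V (i.succAbove a) b + c (i.succAbove a) * V i b)
    (fun _ _ => hU _ _) (fun a b => add_nonneg (hV _ _) (mul_nonneg (hc _) (hV _ _))) ?_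
  · rw [Fintype.card_fin] at h
    omega
  · ext x b
    have hx : U x i = ∑ j, c j * U x j := by
      have := congrFun he x
      simpa using this
    rw [hM, Matrix.mul_apply, Matrix.mul_apply, Fin.sum_univ_succAbove _ i]
    rw [Fin.sum_univ_succAbove _ i, hci, zero_mul, zero_add] at hx
    rw [hx, Finset.sum_mul, ← Finset.sum_add_distrib]
    refine Finset.sum_congr rfl fun a _ => ?_
    simp only [Matrix.submatrix_apply, Matrix.of_apply, id_eq]
    ring

end NonnegRank

/-! ### Homogenized bounded polyhedra -/

section Polyhedron

variable {n f e : ℕ}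

theorem eq_zero_of_ray_subset_of_isBounded {S : Set (Fin n → ℝ)} (hS : Bornology.IsBounded S)
    {x z : Fin n → ℝ} (h : ∀ s : ℝ, 0 ≤ s → x + s • z ∈ S) : z = 0 := by
  obtain ⟨R, hR⟩ := hS.exists_norm_le
  by_contra hz
  have hpos : 0 < ‖z‖ := norm_pos_iff.2 hz
  have hx : ‖x‖ ≤ R := by simpa using hR _ (h 0 le_rfl)
  have hR0 : 0 ≤ R := (norm_nonneg x).trans hx
  have h0 : 0 ≤ (2 * R + 1) / ‖z‖ := by positivity
  have h1 := hR _ (h _ h0)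
  have h2 : ‖((2 * R + 1) / ‖z‖) • z‖ = 2 * R + 1 := by
    rw [norm_smul, Real.norm_of_nonneg h0, div_mul_cancel₀ _ hpos.ne']
  have h3 : ‖((2 * R + 1) / ‖z‖) • z‖ ≤ ‖x + ((2 * R + 1) / ‖z‖) • z‖ + ‖x‖ := by
    have := norm_sub_le (x + ((2 * R + 1) / ‖z‖) • z) x
    rwa [add_sub_cancel_left] at this
  linarith

variable (C : Matrix (Fin f) (Fin n) ℝ) (d : Fin f → ℝ) (A : Matrix (Fin e) (Fin n) ℝ)
  (b : Fin e → ℝ)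

/-- The homogenized system `(x, t) ↦ C x - t d`. It serves for the inequalities, as
`homogeneousSlack C d`, and for the equations, as `homogeneousSlack A b`. -/
noncomputable def homogeneousSlack : (Fin n → ℝ) × ℝ →ₗ[ℝ] (Fin f → ℝ) :=
  C.mulVecLin.comp (LinearMap.fst ℝ _ _) - (LinearMap.snd ℝ _ _).smulRight d

theorem homogeneousSlack_apply (z : (Fin n → ℝ) × ℝ) :
    homogeneousSlack C d z = C *ᵥ z.1 - z.2 • d := by
  simp [homogeneousSlack]

theorem isClosed_polyhedron : IsClosed (polyhedron C d A b) := by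
  refine IsClosed.inter ?_ ?_
  · change IsClosed {x : Fin n → ℝ | ∀ i, d i ≤ (C *ᵥ x) i}
    simp only [Set.ofPred_forall]
    exact isClosed_iInter fun i => isClosed_le continuous_const (by fun_prop)
  · exact isClosed_eq (by fun_prop) continuous_const

theorem convex_polyhedron : Convex ℝ (polyhedron C d A b) := by
  rintro x ⟨hx, hx'⟩ y ⟨hy, hy'⟩ s t hs ht hst
  refine ⟨fun i => ?_, ?_⟩
  · rw [Matrix.mulVec_add, Matrix.mulVec_smul, Matrix.mulVec_smul, Pi.add_apply, Pi.smul_apply,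
      Pi.smul_apply, smul_eq_mul, smul_eq_mul]
    have h1 := mul_le_mul_of_nonneg_left (hx i) hs
    have h2 := mul_le_mul_of_nonneg_left (hy i) ht
    have h3 : d i = s * d i + t * d i := by rw [← add_mul, hst, one_mul]
    linarith
  · rw [Matrix.mulVec_add, Matrix.mulVec_smul, Matrix.mulVec_smul, hx', hy', ← add_smul, hst,
      one_smul]

variable {C d A b}

theorem mem_polyhedron_iff {x : Fin n → ℝ} :
    x ∈ polyhedron C d A b ↔ 0 ≤ homogeneousSlack C d (x, 1) ∧ homogeneousSlack A b (x, 1) = 0 := by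
  rw [homogeneousSlack_apply, homogeneousSlack_apply, one_smul, one_smul, sub_eq_zero, sub_nonneg]
  rfl

theorem homogeneousSlack_smul_inv {t : ℝ} (ht : t ≠ 0) (x : Fin n → ℝ) :
    homogeneousSlack C d (t⁻¹ • x, 1) = t⁻¹ • homogeneousSlack C d (x, t) := by
  rw [← map_smul, Prod.smul_mk, smul_eq_mul, inv_mul_cancel₀ ht]

/-- The homogenization of a bounded polyhedron with at least two points is a cone in the half space
`t > 0`, apart from its apex. -/
theorem eq_zero_or_pos_of_homogeneous (hP : Bornology.IsBounded (polyhedron C d A b))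
    (hP2 : (polyhedron C d A b).Nontrivial) {z : (Fin n → ℝ) × ℝ}
    (hz : 0 ≤ homogeneousSlack C d z) (hz' : homogeneousSlack A b z = 0) : z = 0 ∨ 0 < z.2 := by
  -- for `t ≤ 0`, the vector `x - t y` is a direction of recession for every `y` in the polyhedron
  have key : z.2 ≤ 0 → ∀ y ∈ polyhedron C d A b, z.1 = z.2 • y := by
    intro ht y hy
    rw [← sub_eq_zero]
    refine eq_zero_of_ray_subset_of_isBounded hP (x := y) fun s hs => ?_
    obtain ⟨hy1, hy2⟩ := mem_polyhedron_iff.1 hy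
    have e : (y + s • (z.1 - z.2 • y), (1 : ℝ)) =
        (y, (1 : ℝ)) + s • (z + (-z.2) • (y, (1 : ℝ))) := by
      ext i
      · simp [sub_eq_add_neg]
      · simp
    rw [mem_polyhedron_iff, e]
    simp only [map_add, map_smul, hy2, hz', smul_zero, add_zero, and_true]
    exact add_nonneg hy1 (smul_nonneg hs (add_nonneg hz (smul_nonneg (neg_nonneg.2 ht) hy1)))
  by_contra hcon
  push Not at hcon
  obtain ⟨x, hx, y, hy, hxy⟩ := hP2
  have h1 := key hcon.2 x hx
  have h2 := key hcon.2 y hy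
  have h0 : z.2 = 0 := by
    by_contra h
    exact hxy (smul_right_injective _ h (h1.symm.trans h2))
  rw [h0, zero_smul] at h1
  exact hcon.1 (Prod.ext h1 h0)

theorem homogeneousSlack_injOn (hP : Bornology.IsBounded (polyhedron C d A b))
    (hP2 : (polyhedron C d A b).Nontrivial) :
    Set.InjOn (homogeneousSlack C d) (LinearMap.ker (homogeneousSlack A b)) := by
  intro y hy z hz hyz
  have h1 : homogeneousSlack C d (y - z) = 0 := by rw [map_sub, hyz, sub_self]
  have h2 : homogeneousSlack A b (y - z) = 0 := (LinearMap.ker _).sub_mem hy hz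
  rcases eq_zero_or_pos_of_homogeneous hP hP2 h1.ge h2 with h | h
  · exact sub_eq_zero.1 h
  · rcases eq_zero_or_pos_of_homogeneous hP hP2 (z := -(y - z)) (by rw [map_neg, h1, neg_zero])
      (by rw [map_neg, h2, neg_zero]) with h' | h'
    · exact sub_eq_zero.1 (neg_eq_zero.1 h')
    · rw [Prod.snd_neg] at h'
      linarith

/-- A vertex of a bounded polyhedron spans an extreme ray of the homogenization. -/
theorem mem_span_of_add_eq_smul_extreme (hP : Bornology.IsBounded (polyhedron C d A b))
    (hP2 : (polyhedron C d A b).Nontrivial) {x : Fin n → ℝ}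
    (hx : x ∈ (polyhedron C d A b).extremePoints ℝ) {y z : (Fin n → ℝ) × ℝ} {s : ℝ}
    (hy : 0 ≤ homogeneousSlack C d y) (hy' : homogeneousSlack A b y = 0)
    (hz : 0 ≤ homogeneousSlack C d z) (hz' : homogeneousSlack A b z = 0)
    (hyz : y + z = s • (x, (1 : ℝ))) : y ∈ Submodule.span ℝ {(x, (1 : ℝ))} := by
  rcases eq_zero_or_pos_of_homogeneous hP hP2 hy hy' with rfl | hpy
  · exact Submodule.zero_mem _
  rcases eq_zero_or_pos_of_homogeneous hP hP2 hz hz' with rfl | hpz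
  · rw [add_zero] at hyz
    exact Submodule.mem_span_singleton.2 ⟨s, hyz.symm⟩
  have hmem : ∀ u : (Fin n → ℝ) × ℝ, 0 ≤ homogeneousSlack C d u → homogeneousSlack A b u = 0 →
      0 < u.2 → u.2⁻¹ • u.1 ∈ polyhedron C d A b := by
    intro u hu hu' hpos
    rw [mem_polyhedron_iff, homogeneousSlack_smul_inv hpos.ne', homogeneousSlack_smul_inv hpos.ne']
    exact ⟨smul_nonneg (inv_nonneg.2 hpos.le) hu, by rw [hu', smul_zero]⟩
  have h1 : y.1 + z.1 = s • x := congrArg Prod.fst hyz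
  have h2 : y.2 + z.2 = s := by simpa using congrArg Prod.snd hyz
  have hs : 0 < s := by linarith
  have hxy := hx.2 (hmem y hy hy' hpy) (hmem z hz hz' hpz)
    ⟨y.2 / s, z.2 / s, by positivity, by positivity, by rw [← add_div, h2, div_self hs.ne'], by
      rw [smul_smul, smul_smul, div_mul_eq_mul_div, div_mul_eq_mul_div, mul_inv_cancel₀ hpy.ne',
        mul_inv_cancel₀ hpz.ne', ← smul_add, h1, smul_smul, one_div, inv_mul_cancel₀ hs.ne',
        one_smul]⟩
  refine Submodule.mem_span_singleton.2 ⟨y.2, Prod.ext ?_ ?_⟩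
  · rw [← hxy]
    exact smul_inv_smul₀ hpy.ne' _
  · simp

end Polyhedron

/-! ### The slack matrix -/

section Slack

variable {n f e v : ℕ} {C : Matrix (Fin f) (Fin n) ℝ} {d : Fin f → ℝ}
  {A : Matrix (Fin e) (Fin n) ℝ} {b : Fin e → ℝ} {vert : Fin v → Fin n → ℝ}

theorem slackMatrix_col (j : Fin v) :
    (slackMatrix C d vert).col j = homogeneousSlack C d (vert j, 1) := by
  ext i
  simp [slackMatrix, homogeneousSlack_apply]

theorem convexHull_range_vert (hP : Bornology.IsBounded (polyhedron C d A b))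
    (hv : Set.range vert = (polyhedron C d A b).extremePoints ℝ) :
    convexHull ℝ (Set.range vert) = polyhedron C d A b := by
  have := closure_convexHull_extremePoints
    (Metric.isCompact_of_isClosed_isBounded (isClosed_polyhedron C d A b) hP)
    (convex_polyhedron C d A b)
  rwa [← hv, ((Set.finite_range vert).isClosed_convexHull ℝ).closure_eq] at this

theorem span_homogenized_le_ker (hv : Set.range vert = (polyhedron C d A b).extremePoints ℝ) :
    Submodule.span ℝ (Set.range fun j => (vert j, (1 : ℝ))) ≤
      LinearMap.ker (homogeneousSlack A b) := by
  rw [Submodule.span_le]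
  rintro _ ⟨j, rfl⟩
  have : vert j ∈ (polyhedron C d A b).extremePoints ℝ := hv ▸ ⟨j, rfl⟩
  exact (mem_polyhedron_iff.1 this.1).2

theorem rank_slackMatrix (hP : Bornology.IsBounded (polyhedron C d A b))
    (hP2 : (polyhedron C d A b).Nontrivial)
    (hv : Set.range vert = (polyhedron C d A b).extremePoints ℝ) :
    (slackMatrix C d vert).rank = affDim (polyhedron C d A b) + 1 := by
  have hcol : (slackMatrix C d vert).col = fun j => homogeneousSlack C d (vert j, 1) :=
    funext slackMatrix_col
  have hne : (Set.range vert).Nonempty := by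
    rw [← convexHull_nonempty_iff (𝕜 := ℝ), convexHull_range_vert hP hv]
    exact hP2.nonempty
  have h1 := finrank_span_image_of_injOn (fun j => (vert j, (1 : ℝ))) (homogeneousSlack C d)
    ((homogeneousSlack_injOn hP hP2).mono (span_homogenized_le_ker hv)) Set.univ
  rw [Set.image_univ, Set.image_univ] at h1
  rw [Matrix.rank_eq_finrank_span_cols, hcol, h1, ← convexHull_range_vert hP hv, affDim,
    ← direction_affineSpan, affineSpan_convexHull, direction_affineSpan,
    ← finrank_span_prod_one hne, ← Set.range_comp]
  rfl

theorem slackMatrix_nonneg (hv : Set.range vert = (polyhedron C d A b).extremePoints ℝ) (i : Fin f)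
    (j : Fin v) : 0 ≤ slackMatrix C d vert i j := by
  have h : vert j ∈ (polyhedron C d A b).extremePoints ℝ := hv ▸ ⟨j, rfl⟩
  exact sub_nonneg.2 (h.1.1 i)

end Slack

/-! ### The number of vertices -/

theorem ConicallyIrredundant.smul {ι E : Type*} [Fintype ι] [AddCommGroup E] [Module ℝ E]
    {w : ι → E} (hw : ConicallyIrredundant w) {a : ι → ℝ} (ha : ∀ i, 0 < a i) :
    ConicallyIrredundant fun i => a i • w i := by
  intro i c hc hci he
  refine hw i (fun j => (a i)⁻¹ * (c j * a j)) (fun j => ?_) (by simp [hci]) ?_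
  · exact mul_nonneg (inv_nonneg.2 (ha i).le) (mul_nonneg (hc j) (ha j).le)
  · simp only [mul_smul]
    rw [← Finset.smul_sum, ← he, inv_smul_smul₀ (ha i).ne']

section Slack

variable {n f e v : ℕ} {C : Matrix (Fin f) (Fin n) ℝ} {d : Fin f → ℝ}
  {A : Matrix (Fin e) (Fin n) ℝ} {b : Fin e → ℝ} {vert : Fin v → Fin n → ℝ}

/-- The number of vertices is at most `φ (rank, nonnegative rank)` of the slack matrix. The columns
of the left factor of an optimal nonnegative factorization generate a cone over a polytope `T` with
as many vertices as the nonnegative rank, and the polytope is a section of `T` by an affine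
subspace. Each vertex lies on a face of `T` of complementary dimension that meets the subspace in
that vertex only, so that different vertices get different faces. -/
theorem card_vertices_le_phi (hP : Bornology.IsBounded (polyhedron C d A b))
    (hP2 : (polyhedron C d A b).Nontrivial) (hinj : Function.Injective vert)
    (hv : Set.range vert = (polyhedron C d A b).extremePoints ℝ) {r k : ℕ}
    (hr : r = (slackMatrix C d vert).rank) (hk : k = nonnegRank (slackMatrix C d vert)) :
    v ≤ phi r k := by
  obtain ⟨U, V, hU, hV, hM⟩ := exists_nonneg_factorization (slackMatrix_nonneg hv) hk
  have hirr := conicallyIrredundant_col_of_eq_nonnegRank hk hU hV hM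
  have hrank := rank_slackMatrix hP hP2 hv
  have hcolΦ := slackMatrix_col (C := C) (d := d) (vert := vert)
  generalize slackMatrix C d vert = M at *
  -- the generators are normalized to have coordinate sum `1`
  let σ : Module.Dual ℝ (Fin f → ℝ) := ∑ x, LinearMap.proj x
  have hσ : ∀ y : Fin f → ℝ, σ y = ∑ x, y x := fun y => by simp [σ]
  have hσpos : ∀ i, 0 < σ (U.col i) := by
    intro i
    rw [hσ]
    refine lt_of_le_of_ne (Finset.sum_nonneg fun x _ => hU x i) fun h0 => ?_
    refine hirr i 0 (fun _ => le_rfl) rfl ?_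
    have h1 := (Finset.sum_eq_zero_iff_of_nonneg fun x _ => hU x i).1 h0.symm
    ext x
    simpa using h1 x (Finset.mem_univ x)
  let w : Fin k → Fin f → ℝ := fun i => (σ (U.col i))⁻¹ • U.col i
  have hw : ConicallyIrredundant w := hirr.smul fun i => inv_pos.2 (hσpos i)
  have hwσ : ∀ i, σ (w i) = 1 := fun i => by
    simp only [w, map_smul, smul_eq_mul]
    exact inv_mul_cancel₀ (hσpos i).ne'
  have hw0 : ∀ c : Fin k → ℝ, (∀ i, 0 ≤ c i) → 0 ≤ ∑ i, c i • w i := fun c hc =>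
    Finset.sum_nonneg fun i _ => smul_nonneg (hc i)
      (smul_nonneg (inv_nonneg.2 (hσpos i).le) fun x => hU x i)
  have hcol : ∀ j, M.col j = ∑ i, (V i j * σ (U.col i)) • w i := by
    intro j
    have h1 : ∀ i, (V i j * σ (U.col i)) • w i = V i j • U.col i := fun i => by
      simp only [w]
      rw [smul_smul, mul_assoc, mul_inv_cancel₀ (hσpos i).ne', mul_one]
    ext x
    rw [Finset.sum_congr rfl fun i _ => h1 i, hM]
    simp [Matrix.mul_apply, mul_comm]
  set W := Submodule.span ℝ (Set.range w) with hW
  set L := Submodule.span ℝ (Set.range M.col) with hL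
  have hLr : Module.finrank ℝ L = r := by rw [hr, Matrix.rank_eq_finrank_span_cols]
  have hLW : L ≤ W := by
    rw [hL, Submodule.span_le]
    rintro _ ⟨j, rfl⟩
    rw [hcol]
    exact W.sum_mem fun i _ => W.smul_mem _ (Submodule.subset_span ⟨i, rfl⟩)
  have hLmap : L = (Submodule.span ℝ (Set.range fun j => (vert j, (1 : ℝ)))).map
      (homogeneousSlack C d) := by
    rw [Submodule.map_span, ← Set.range_comp, hL]
    congr 2
    exact funext hcolΦ
  have hker := span_homogenized_le_ker hv
  have hvmem : ∀ j, (vert j, (1 : ℝ)) ∈ LinearMap.ker (homogeneousSlack A b) := fun j =>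
    hker (Submodule.subset_span ⟨j, rfl⟩)
  -- an element of `L` in the cone lies in the orthant, so it comes from the homogenized polytope,
  -- where the vertices span extreme rays
  have hface : ∀ j, ∃ (l : Module.Dual ℝ (Fin f → ℝ)) (I : Set (Fin k)), (∀ i, 0 ≤ l (w i)) ∧
      I = {i | l (w i) = 0} ∧ Submodule.span ℝ (w '' I) ⊔ L = W ∧
      Submodule.span ℝ (w '' I) ⊓ L = Submodule.span ℝ {M.col j} := by
    intro j
    have hjL : M.col j ∈ L := Submodule.subset_span ⟨j, rfl⟩
    refine exists_transversal_face w hLW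
      (fun i => mul_nonneg (hV i j) (hσpos i).le) (hcol j) hjL ?_
    intro p hpL c c' s s' hc hc' hp hp'
    have h1 : p - s • M.col j ∈ L := L.sub_mem hpL (L.smul_mem _ hjL)
    have h2 : -p - s' • M.col j ∈ L := L.sub_mem (L.neg_mem hpL) (L.smul_mem _ hjL)
    have h10 : 0 ≤ p - s • M.col j := by rw [hp, add_sub_cancel_right]; exact hw0 c hc
    have h20 : 0 ≤ -p - s' • M.col j := by rw [hp', add_sub_cancel_right]; exact hw0 c' hc'
    rw [hLmap] at h1 h2
    obtain ⟨y, hy, hye⟩ := h1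
    obtain ⟨z, hz, hze⟩ := h2
    have hyz : y + z = (-(s + s')) • (vert j, (1 : ℝ)) := by
      refine homogeneousSlack_injOn hP hP2 ((LinearMap.ker _).add_mem (hker hy) (hker hz))
        ((LinearMap.ker _).smul_mem _ (hvmem j)) ?_
      rw [map_add, hye, hze, map_smul, ← hcolΦ, neg_smul, add_smul]
      abel
    obtain ⟨t, ht⟩ := Submodule.mem_span_singleton.1 (mem_span_of_add_eq_smul_extreme hP hP2
      (hv ▸ ⟨j, rfl⟩) (hye.symm ▸ h10) (hker hy) (hze.symm ▸ h20) (hker hz) hyz)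
    refine Submodule.mem_span_singleton.2 ⟨t + s, ?_⟩
    rw [← ht, map_smul, ← hcolΦ] at hye
    rw [add_smul, hye, sub_add_cancel]
  choose l I hl0 hI hsup hinf using hface
  have hIinj : Function.Injective I := by
    intro i j hij
    have h1 := hinf i
    rw [hij, hinf j] at h1
    have h2 : M.col j ∈ Submodule.span ℝ {M.col i} := h1 ▸ Submodule.mem_span_singleton_self _
    obtain ⟨t, ht⟩ := Submodule.mem_span_singleton.1 h2
    rw [hcolΦ, hcolΦ, ← map_smul] at ht
    have h3 := homogeneousSlack_injOn hP hP2 ((LinearMap.ker _).smul_mem t (hvmem i)) (hvmem j) ht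
    have h4 : t * 1 = 1 := congrArg Prod.snd h3
    have h5 : t • vert i = vert j := congrArg Prod.fst h3
    rw [mul_one] at h4
    rw [h4, one_smul] at h5
    exact hinj h5
  have hrW : r ≤ Module.finrank ℝ W := hLr ▸ Submodule.finrank_mono hLW
  have hWk : Module.finrank ℝ W ≤ k := by
    have h := finrank_range_le_card (R := ℝ) w
    rwa [Fintype.card_fin] at h
  obtain ⟨u, hu⟩ : ∃ u, Module.finrank ℝ W = u + 1 := ⟨Module.finrank ℝ W - 1, by omega⟩
  have hmem : Set.range I ⊆ faceIndexSets w (u + 1 - r + 1) := by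
    rintro _ ⟨j, rfl⟩
    refine ⟨l j, hl0 j, hI j, ?_⟩
    have hne : M.col j ≠ 0 := by
      intro h0
      rw [hcolΦ, ← map_zero (homogeneousSlack C d)] at h0
      have h1 := homogeneousSlack_injOn hP hP2 (hvmem j) (Submodule.zero_mem _) h0
      exact one_ne_zero (congrArg Prod.snd h1)
    have h1 := Submodule.finrank_sup_add_finrank_inf_eq (Submodule.span ℝ (w '' I j)) L
    rw [hsup, hinf, finrank_span_singleton hne, hLr] at h1
    omega
  calc v = (Set.range I).ncard := by
        rw [← Set.image_univ, Set.ncard_image_of_injective _ hIinj, Set.ncard_univ, Nat.card_fin]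
    _ ≤ (faceIndexSets w (u + 1 - r + 1)).ncard := Set.ncard_le_ncard hmem (Set.toFinite _)
    _ ≤ maxFaces k u (u + 1 - r) := by
        simpa using ncard_faceIndexSets_le_maxFaces hw σ hwσ hu (u + 1 - r)
    _ ≤ phi r k := Finset.le_sup (s := Finset.Icc r k) (f := fun u => maxFaces k (u - 1) (u - r))
        (b := u + 1) (Finset.mem_Icc.2 ⟨hu ▸ hrW, hu ▸ hWk⟩)

/-! ### Extended formulations -/

/-- **Yannakakis' lower bound**: by Farkas' lemma, the inequalities of the polytope are nonnegative
combinations of those of an extended formulation, up to constants. This factors the slack matrix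
through the slacks of the inequalities of the extended formulation. -/
theorem nonnegRank_add_le_of_hasExtendedFormulation
    (hP : Bornology.IsBounded (polyhedron C d A b)) (hP2 : (polyhedron C d A b).Nontrivial)
    (hv : Set.range vert = (polyhedron C d A b).extremePoints ℝ) {s : ℕ}
    (hs : HasExtendedFormulation (polyhedron C d A b) s) :
    n ≤ s ∧ nonnegRank (slackMatrix C d vert) + n ≤ s + 1 := by
  obtain ⟨p, q, t, E, F, g, G, H, h, hPQ, rfl⟩ := hs
  refine ⟨by omega, ?_⟩
  suffices hq : nonnegRank (slackMatrix C d vert) ≤ q + 1 by omega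
  have hmem : ∀ x, x ∈ polyhedron C d A b ↔ ∃ y : Fin p → ℝ,
      (∀ i, g i ≤ (E *ᵥ x + F *ᵥ y) i) ∧ G *ᵥ x + H *ᵥ y = h := fun x => by
    rw [hPQ]; rfl
  have hvP : ∀ j, vert j ∈ polyhedron C d A b := fun j =>
    (show vert j ∈ (polyhedron C d A b).extremePoints ℝ from hv ▸ ⟨j, rfl⟩).1
  choose y hy hy' using fun j => (hmem (vert j)).1 (hvP j)
  -- the homogenized inequalities and equations of the extended formulation
  let X := (Fin n → ℝ) × (Fin p → ℝ) × ℝ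
  let x₁ : X →ₗ[ℝ] (Fin n → ℝ) := LinearMap.fst ℝ _ _
  let y₁ : X →ₗ[ℝ] (Fin p → ℝ) := (LinearMap.fst ℝ _ _).comp (LinearMap.snd ℝ _ _)
  let t₁ : X →ₗ[ℝ] ℝ := (LinearMap.snd ℝ _ _).comp (LinearMap.snd ℝ _ _)
  let Φ : X →ₗ[ℝ] (Fin q → ℝ) := E.mulVecLin.comp x₁ + F.mulVecLin.comp y₁ - t₁.smulRight g
  let Ψ : X →ₗ[ℝ] (Fin t → ℝ) := G.mulVecLin.comp x₁ + H.mulVecLin.comp y₁ - t₁.smulRight h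
  have hΦ : ∀ a c s, Φ (a, c, s) = E *ᵥ a + F *ᵥ c - s • g := fun a c s => rfl
  have hΨ : ∀ a c s, Ψ (a, c, s) = G *ᵥ a + H *ᵥ c - s • h := fun a c s => rfl
  have hone : ∀ a c, 0 ≤ Φ (a, c, 1) → Ψ (a, c, 1) = 0 → a ∈ polyhedron C d A b := by
    intro a c h1 h2
    rw [hΦ, one_smul, sub_nonneg] at h1
    rw [hΨ, one_smul, sub_eq_zero] at h2
    exact (hmem a).2 ⟨c, h1, h2⟩
  let φ : Option (Fin q) → Module.Dual ℝ (LinearMap.ker Ψ) := fun o =>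
    (o.elim t₁ fun i => (LinearMap.proj i).comp Φ).comp (LinearMap.ker Ψ).subtype
  let ψ : Fin f → Module.Dual ℝ (LinearMap.ker Ψ) := fun i =>
    ((LinearMap.proj i).comp ((homogeneousSlack C d).comp (x₁.prod t₁))).comp
      (LinearMap.ker Ψ).subtype
  -- Farkas' lemma is applied on the solution space of the equations, which therefore need no
  -- multipliers
  have hvalid : ∀ i z, (∀ o, 0 ≤ φ o z) → 0 ≤ ψ i z := by
    rintro i ⟨⟨a, c, s⟩, hz⟩ hφ
    have hs : 0 ≤ s := hφ none
    have hΦ0 : 0 ≤ Φ (a, c, s) := fun i => hφ (some i)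
    have hΨ0 : Ψ (a, c, s) = 0 := hz
    suffices h0 : 0 ≤ homogeneousSlack C d (a, s) from h0 i
    -- at height `0` there are only directions of recession, which project to `0` by boundedness
    rcases hs.eq_or_lt with rfl | hs
    · obtain ⟨x₀, hx₀⟩ := hP2.nonempty
      obtain ⟨y₀, h1, h2⟩ := (hmem x₀).1 hx₀
      have h1' : 0 ≤ Φ (x₀, y₀, 1) := by
        rw [hΦ, one_smul, sub_nonneg]
        exact h1
      have h2' : Ψ (x₀, y₀, 1) = 0 := by rw [hΨ, one_smul, h2, sub_self]
      have ha : a = 0 := by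
        refine eq_zero_of_ray_subset_of_isBounded hP (x := x₀) fun s hs => ?_
        have e : ((x₀ + s • a, y₀ + s • c, 1) : X) = (x₀, y₀, 1) + s • (a, c, 0) := by simp
        refine hone _ (y₀ + s • c) ?_ ?_
        · rw [e, map_add, map_smul]
          exact add_nonneg h1' (smul_nonneg hs hΦ0)
        · rw [e, map_add, map_smul, h2', hΨ0, smul_zero, add_zero]
      rw [ha, Prod.mk_zero_zero, map_zero]
    · have e : ((s⁻¹ • a, s⁻¹ • c, 1) : X) = s⁻¹ • (a, c, s) := by
        simp [inv_mul_cancel₀ hs.ne']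
      have hm : s⁻¹ • a ∈ polyhedron C d A b := by
        refine hone _ (s⁻¹ • c) ?_ ?_
        · rw [e, map_smul]
          exact smul_nonneg (inv_nonneg.2 hs.le) hΦ0
        · rw [e, map_smul, hΨ0, smul_zero]
      have h3 := (mem_polyhedron_iff.1 hm).1
      rw [homogeneousSlack_smul_inv hs.ne'] at h3
      have h4 := smul_nonneg hs.le h3
      rwa [smul_inv_smul₀ hs.ne'] at h4
  choose c hc hψ using fun i => exists_nonneg_combination_of_forall_nonneg' φ (ψ i) (hvalid i)
  let z : Fin v → LinearMap.ker Ψ := fun j =>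
    ⟨(vert j, y j, 1), by rw [LinearMap.mem_ker, hΨ, one_smul, hy' j, sub_self]⟩
  have hle := nonnegRank_le_card (M := slackMatrix C d vert) (Matrix.of c)
    (Matrix.of fun o j => φ o (z j)) hc ?_ ?_
  · simpa using hle
  · rintro (_ | i) j
    · exact zero_le_one
    · change 0 ≤ Φ (vert j, y j, 1) i
      rw [hΦ, one_smul, Pi.sub_apply, sub_nonneg]
      exact hy j i
  · ext i j
    have h1 : slackMatrix C d vert i j = ψ i (z j) := congrFun (slackMatrix_col j) i
    rw [h1, hψ i, Matrix.mul_apply]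
    simp

/-- A solvable system of linear equations is equivalent to one with as many equations as there are
variables. -/
theorem exists_equations_of_linearMap {p : ℕ} {Z : Type*} [AddCommGroup Z] [Module ℝ Z]
    (Ψ : (Fin n → ℝ) × (Fin p → ℝ) →ₗ[ℝ] Z) (z₀ : (Fin n → ℝ) × (Fin p → ℝ)) :
    ∃ (G : Matrix (Fin (n + p)) (Fin n) ℝ) (H : Matrix (Fin (n + p)) (Fin p) ℝ)
      (h : Fin (n + p) → ℝ), ∀ x y, G *ᵥ x + H *ᵥ y = h ↔ Ψ (x, y) = Ψ z₀ := by
  let ε : ((Fin n → ℝ) × (Fin p → ℝ)) ≃ₗ[ℝ] (Fin (n + p) → ℝ) :=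
    LinearEquiv.ofFinrankEq _ _ (by simp)
  obtain ⟨g, hg⟩ := (LinearMap.ker Ψ).subtype.exists_leftInverse_of_injective
    (Submodule.ker_subtype _)
  let ρ := LinearMap.id - (LinearMap.ker Ψ).subtype.comp g
  have hρ : ∀ z, ρ z = 0 ↔ Ψ z = 0 := by
    intro z
    constructor
    · intro h
      have h1 : z = (g z : (Fin n → ℝ) × (Fin p → ℝ)) := sub_eq_zero.1 h
      rw [h1]
      exact (g z).2
    · intro h
      have h1 : g z = ⟨z, h⟩ := LinearMap.congr_fun hg ⟨z, h⟩
      simp [ρ, h1]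
  let T := ε.toLinearMap.comp ρ
  refine ⟨LinearMap.toMatrix' (T.comp (LinearMap.inl ℝ _ _)),
    LinearMap.toMatrix' (T.comp (LinearMap.inr ℝ _ _)), T z₀, fun x y => ?_⟩
  rw [LinearMap.toMatrix'_mulVec, LinearMap.toMatrix'_mulVec]
  change T (x, 0) + T (0, y) = T z₀ ↔ _
  rw [← map_add, Prod.mk_add_mk, add_zero, zero_add, ← sub_eq_zero, ← map_sub,
    ← sub_eq_zero (a := Ψ _), ← map_sub, ← hρ]
  exact ε.map_eq_zero_iff

/-- A nonnegative factorization `U * V` of the slack matrix yields the extended formulation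
`C x - d = U y`, `A x = b`, `y ≥ 0`. -/
theorem hasExtendedFormulation_nonnegRank (hP : Bornology.IsBounded (polyhedron C d A b))
    (hP2 : (polyhedron C d A b).Nontrivial)
    (hv : Set.range vert = (polyhedron C d A b).extremePoints ℝ) {k : ℕ}
    (hk : k = nonnegRank (slackMatrix C d vert)) :
    HasExtendedFormulation (polyhedron C d A b) ((n + k) + (k + (n + k))) := by
  obtain ⟨U, V, hU, hV, hM⟩ := exists_nonneg_factorization (slackMatrix_nonneg hv) hk
  obtain ⟨x₀, hx₀⟩ := hP2.nonempty
  have lift : ∀ x ∈ polyhedron C d A b, ∃ y : Fin k → ℝ, 0 ≤ y ∧ C *ᵥ x - U *ᵥ y = d := by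
    intro x hx
    rw [← convexHull_range_vert hP hv, mem_convexHull_range_iff] at hx
    obtain ⟨c, hc, hc1, rfl⟩ := hx
    refine ⟨V *ᵥ c, fun i => ?_, ?_⟩
    · exact Finset.sum_nonneg (s := Finset.univ) (f := fun j => V i j * c j)
        fun j _ => mul_nonneg (hV i j) (hc j)
    have h1 : U *ᵥ (V *ᵥ c) = ∑ j, c j • homogeneousSlack C d (vert j, 1) := by
      rw [Matrix.mulVec_mulVec, ← hM]
      ext i
      simp_rw [← slackMatrix_col]
      simp [Matrix.mulVec, dotProduct, mul_comm]
    have h2 : C *ᵥ (∑ j, c j • vert j) - d = ∑ j, c j • homogeneousSlack C d (vert j, 1) := by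
      have h3 : ((∑ j, c j • vert j, 1) : (Fin n → ℝ) × ℝ) = ∑ j, c j • (vert j, (1 : ℝ)) := by
        ext i
        · simp [Prod.fst_sum]
        · simp [Prod.snd_sum, hc1]
      have h4 := homogeneousSlack_apply C d (∑ j, c j • vert j, 1)
      rw [one_smul] at h4
      rw [← h4, h3, map_sum]
      simp_rw [map_smul]
    rw [h1, ← h2, sub_sub_cancel]
  obtain ⟨y₀, -, hy₀⟩ := lift x₀ hx₀
  let Ψ : (Fin n → ℝ) × (Fin k → ℝ) →ₗ[ℝ] (Fin f → ℝ) × (Fin e → ℝ) :=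
    (C.mulVecLin.comp (LinearMap.fst ℝ _ _) - U.mulVecLin.comp (LinearMap.snd ℝ _ _)).prod
      (A.mulVecLin.comp (LinearMap.fst ℝ _ _))
  have hΨ : ∀ x y, Ψ (x, y) = (C *ᵥ x - U *ᵥ y, A *ᵥ x) := fun x y => rfl
  obtain ⟨G, H, h, hGH⟩ := exists_equations_of_linearMap Ψ (x₀, y₀)
  rw [hΨ x₀ y₀, hy₀, hx₀.2] at hGH
  refine ⟨k, k, n + k, 0, 1, 0, G, H, h, ?_, rfl⟩
  ext x
  constructor
  · intro hx
    obtain ⟨y, hy, hxy⟩ := lift x hx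
    refine ⟨y, fun i => by simpa using hy i, (hGH x y).2 ?_⟩
    rw [hΨ, hxy, hx.2]
  · rintro ⟨y, hy, hxy⟩
    rw [hGH, hΨ, Prod.mk.injEq] at hxy
    refine ⟨fun i => ?_, hxy.2⟩
    have h0 : 0 ≤ (U *ᵥ y) i :=
      Finset.sum_nonneg (s := Finset.univ) (f := fun j => U i j * y j)
        fun j _ => mul_nonneg (hU i j) (by simpa using hy j)
    have h1 := congrFun hxy.1 i
    rw [Pi.sub_apply] at h1
    linarith

end Slack

/-! ### The bounds together -/

theorem logb_le_phiInv {r v k : ℕ} (hv : 0 < v) (h : v ≤ phi r k) :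
    Real.logb 2 v ≤ phiInv r v := by
  have h1 : v ≤ phi r (phiInv r v) := Nat.sInf_mem (s := {k : ℕ | v ≤ phi r k}) ⟨k, h⟩
  rw [Real.logb_le_iff_le_rpow one_lt_two (by exact_mod_cast hv), Real.rpow_natCast]
  exact_mod_cast h1.trans (phi_le_two_pow _ _)

theorem mainTheorem10 :
    ∃ c₁ c₂ c₃ : ℝ, 0 < c₁ ∧ 0 < c₂ ∧ 0 < c₃ ∧
      ∀ (n f e v : ℕ) (C : Matrix (Fin f) (Fin n) ℝ) (d : Fin f → ℝ)
        (A : Matrix (Fin e) (Fin n) ℝ) (b : Fin e → ℝ) (vert : Fin v → (Fin n → ℝ))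
        (P : Set (Fin n → ℝ)) (r rp : ℕ),
        P = polyhedron C d A b →
        Bornology.IsBounded P →
        Function.Injective vert →
        Set.range vert = P.extremePoints ℝ →
        1 < v →
        r = (slackMatrix C d vert).rank →
        rp = nonnegRank (slackMatrix C d vert) →
        -- `P` has dimension `r - 1`
        affDim P + 1 = r ∧
        -- the chain of upper bounds on the number of vertices
        v ≤ phi r rp ∧
        phi r rp ≤ (Finset.Icc r rp).sup (fun u => rp.choose (u - r + 1)) ∧
        (Finset.Icc r rp).sup (fun u => rp.choose (u - r + 1)) ≤ rp.choose (rp / 2) ∧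
        rp.choose (rp / 2) ≤ 2 ^ rp ∧
        -- the minimum size of an extended formulation is of order `rp + n`
        c₁ * ((rp : ℝ) + n) ≤ minExtendedSize P ∧
        (minExtendedSize P : ℝ) ≤ c₂ * ((rp : ℝ) + n) ∧
        -- it is at least of order `φ_r⁻¹(v)`, which is at least `log₂ v`
        Monotone (phi r) ∧
        phiInv r v ≤ rp ∧
        c₃ * (phiInv r v : ℝ) ≤ minExtendedSize P ∧
        Real.logb 2 v ≤ phiInv r v := by
  -- `rp + n ≤ s + 1` and `1 ≤ n ≤ s` give `rp + n ≤ 2 s`; conversely `s ≤ 2 n + 3 rp`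
  refine ⟨1 / 2, 3, 1 / 2, by norm_num, by norm_num, by norm_num, ?_⟩
  rintro n f e v C d A b vert P r rp rfl hP hinj hv hv1 hr hrp
  have hP2 : (polyhedron C d A b).Nontrivial := by
    have hmem : ∀ j, vert j ∈ polyhedron C d A b := fun j =>
      (show vert j ∈ (polyhedron C d A b).extremePoints ℝ from hv ▸ ⟨j, rfl⟩).1
    refine ⟨_, hmem ⟨0, by omega⟩, _, hmem ⟨1, hv1⟩, fun h => ?_⟩
    simpa using hinj h
  have hn : 1 ≤ n := by
    by_contra h
    obtain rfl : n = 0 := by omega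
    obtain ⟨x, -, y, -, hxy⟩ := hP2
    exact hxy (Subsingleton.elim _ _)
  have hdim : affDim (polyhedron C d A b) + 1 = r := by rw [hr, rank_slackMatrix hP hP2 hv]
  have hphi := card_vertices_le_phi hP hP2 hinj hv hr hrp
  have hup := hasExtendedFormulation_nonnegRank hP hP2 hv hrp
  have hmin : minExtendedSize (polyhedron C d A b) ≤ (n + rp) + (rp + (n + rp)) := Nat.sInf_le hup
  obtain ⟨hlo1, hlo2⟩ := nonnegRank_add_le_of_hasExtendedFormulation hP hP2 hv
    (Nat.sInf_mem (s := {s : ℕ | HasExtendedFormulation (polyhedron C d A b) s}) ⟨_, hup⟩)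
  change n ≤ minExtendedSize (polyhedron C d A b) at hlo1
  change _ ≤ minExtendedSize (polyhedron C d A b) + 1 at hlo2
  rw [← hrp] at hlo2
  have hlow : rp + n ≤ 2 * minExtendedSize (polyhedron C d A b) := by omega
  have hlowR : ((rp : ℝ) + n) ≤ 2 * (minExtendedSize (polyhedron C d A b) : ℝ) := by
    exact_mod_cast hlow
  have hinv : phiInv r v ≤ rp := Nat.sInf_le hphi
  refine ⟨hdim, hphi, phi_le_sup_choose r rp, Finset.sup_le fun u _ => Nat.choose_le_middle _ _,
    Nat.choose_le_two_pow _ _, by linarith, ?_, monotone_phi (by omega), hinv, ?_,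
    logb_le_phiInv (by omega) hphi⟩
  · have hminR : (minExtendedSize (polyhedron C d A b) : ℝ) ≤ (n + rp) + (rp + (n + rp)) := by
      exact_mod_cast hmin
    have : (0 : ℝ) ≤ n := Nat.cast_nonneg n
    linarith
  · have hinvR : (phiInv r v : ℝ) ≤ rp := by exact_mod_cast hinv
    have : (0 : ℝ) ≤ n := Nat.cast_nonneg n
    linarith
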